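/- Let $E$ be the elliptic curve $y^2=x^3+7x^2+2x$ over $\mathbb{Q}$ and let $P=(-2,4)\in E(\mathbb{Q})$. For $n\ge 1$ write $nP=\left(\frac{a_n}{B_n^2},\frac{c_n}{B_n^3}\right)$ with integers $a_n,B_n,c_n$, where $B_n>0$ is coprime to $a_n$ and to $c_n$; $\{B_n\}_{n\ge 1}$ is the elliptic divisibility sequence associated to $P$. Let $D=\{5,13,29,41,53\}$ and let $R_D$ be the set of primes $p$ that are inert in $\mathbb{Q}(\sqrt d)$ for at least one $d\in D$. Say that $B_n$ has a primitive odd order divisor from $R_D$ if there is a prime $p\in R_D$ such that $v_p(B_n)$ is odd and $v_p(B_i)=0$ for all $1\le i<n$. Let $$S=\{\,s \text{ prime} : B_s \text{ has a primitive odd order divisor from } R_D\,\}.$$ Then $S$ has (lower) Dirichlet density at least $43/45\ge 95.5\%$, that is, $$\liminf_{t\to 1^+}\frac{\sum_{s\in S}s^{-t}}{\sum_{p\text{ prime}}p^{-t}}\ \ge\ \frac{43}{45}\ \ge\ \frac{95.5}{100}.$$ -/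

import Mathlib

open scoped NumberField

/-- The denominator `B` of a rational point: a point with affine coordinates `(x, y)` has
`x = a / B ^ 2`, `y = c / B ^ 3` with `a / B ^ 2` and `c / B ^ 3` in lowest terms
(see `pointDenominator_spec`), so `B ^ 2` is the reduced denominator of `x`.  Of the two signs
allowed for `B` we take the positive one.  The point at infinity has `B = 0`. -/
def pointDenominator {W : WeierstrassCurve.Affine ℚ} : W.Point → ℕ
  | .zero => 0
  | .some x _ _ => Nat.sqrt x.den

/-- The elliptic divisibility sequence `B_n` associated to a rational point `P`: the denominators
of the multiples `n • P`. -/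
def ellDivSeq {W : WeierstrassCurve.Affine ℚ} (P : W.Point) (n : ℕ) : ℕ :=
  pointDenominator (n • P)

/-- On a Weierstrass model `y² = x³ + a x² + b x + c` with integral coefficients, the number
`pointDenominator` is the positive integer `B` with `(x, y) = (u / B², v / B³)` and
`u`, `v` coprime to `B`. -/
theorem pointDenominator_spec {W : WeierstrassCurve.Affine ℚ} (a b c : ℤ)
    (h₁ : W.a₁ = 0) (h₂ : W.a₂ = a) (h₃ : W.a₃ = 0) (h₄ : W.a₄ = b) (h₆ : W.a₆ = c)
    (x y : ℚ) (h : W.Nonsingular x y) :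
    0 < pointDenominator (WeierstrassCurve.Affine.Point.some x y h) ∧
      ∃ u v : ℤ,
        IsCoprime u (pointDenominator (WeierstrassCurve.Affine.Point.some x y h) : ℤ) ∧
        IsCoprime v (pointDenominator (WeierstrassCurve.Affine.Point.some x y h) : ℤ) ∧
        x = u / (pointDenominator (WeierstrassCurve.Affine.Point.some x y h) : ℚ) ^ 2 ∧
        y = v / (pointDenominator (WeierstrassCurve.Affine.Point.some x y h) : ℚ) ^ 3 := by
  have heq := (WeierstrassCurve.Affine.equation_iff x y).1 h.1
  rw [h₁, h₂, h₃, h₄, h₆] at heq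
  have hx := Rat.num_div_den x
  have hy := Rat.num_div_den y
  have key : y.num ^ 2 * (x.den : ℤ) ^ 3 = (y.den : ℤ) ^ 2 *
      (x.num ^ 3 + x.den * (a * x.num ^ 2 + b * x.num * x.den + c * (x.den : ℤ) ^ 2)) := by
    have : (y.num : ℚ) ^ 2 * (x.den : ℚ) ^ 3 = (y.den : ℚ) ^ 2 *
        (x.num ^ 3 + x.den * (a * x.num ^ 2 + b * x.num * x.den + c * (x.den : ℚ) ^ 2)) := by
      have hxn : (x.num : ℚ) = x * x.den := (Rat.mul_den_eq_num x).symm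
      have hyn : (y.num : ℚ) = y * y.den := (Rat.mul_den_eq_num y).symm
      rw [hxn, hyn]
      linear_combination ((x.den : ℚ) ^ 3 * (y.den : ℚ) ^ 2) * heq
    exact_mod_cast this
  have cx : IsCoprime x.num (x.den : ℤ) := Rat.isCoprime_num_den x
  have cy : IsCoprime y.num (y.den : ℤ) := Rat.isCoprime_num_den y
  have d1 : (y.den : ℤ) ^ 2 ∣ (x.den : ℤ) ^ 3 :=
    (cy.symm.pow (m := 2) (n := 2)).dvd_of_dvd_mul_left ⟨_, key⟩
  have cc : IsCoprime ((x.den : ℤ) ^ 3)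
      (x.num ^ 3 + x.den * (a * x.num ^ 2 + b * x.num * x.den + c * (x.den : ℤ) ^ 2)) :=
    IsCoprime.pow_left ((cx.symm.pow_right (n := 3)).add_mul_left_right _)
  have d2 : (x.den : ℤ) ^ 3 ∣ (y.den : ℤ) ^ 2 :=
    cc.dvd_of_dvd_mul_right ⟨y.num ^ 2, by rw [← key]; ring⟩
  have e : y.den ^ 2 = x.den ^ 3 :=
    Nat.dvd_antisymm (by exact_mod_cast d1) (by exact_mod_cast d2)
  obtain ⟨t, ht⟩ : x.den ∣ y.den :=
    (Nat.pow_dvd_pow_iff two_ne_zero).1 ⟨x.den, by rw [e]; ring⟩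
  have hxt : x.den = t * t := by
    have hpos : 0 < x.den ^ 2 := by have := x.den_pos; positivity
    apply Nat.eq_of_mul_eq_mul_left hpos
    rw [ht] at e
    linarith [e]
  have hyt : y.den = t ^ 3 := by rw [ht, hxt]; ring
  have hB : pointDenominator (WeierstrassCurve.Affine.Point.some x y h) = t := by
    simp [pointDenominator, hxt, Nat.sqrt_eq]
  rw [hB]
  refine ⟨Nat.pos_of_ne_zero fun h0 => x.den_ne_zero (by simp [hxt, h0]), x.num, y.num, ?_, ?_,
    ?_, ?_⟩
  · rw [hxt] at cx
    push_cast at cx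
    exact cx.of_mul_right_left
  · rw [hyt] at cy
    push_cast at cy
    exact (IsCoprime.pow_right_iff (by norm_num : 0 < 3)).1 cy
  · conv_lhs => rw [← hx, hxt]
    push_cast
    ring
  · conv_lhs => rw [← hy, hyt]
    push_cast
    ring

/-- The quadratic field `ℚ(√d)`, for a natural number `d`, as a subfield of `ℝ`. -/
noncomputable abbrev realQuadraticField (d : ℕ) : IntermediateField ℚ ℝ :=
  IntermediateField.adjoin ℚ {√(d : ℝ)}

/-- The rational prime `p` is inert in `ℚ(√d)`: it generates a prime ideal of the ring of
integers. -/
def IsInertPrime (p d : ℕ) : Prop :=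
  p.Prime ∧ (Ideal.span {(p : 𝓞 (realQuadraticField d))}).IsPrime

/-- `R_D`: the set of primes inert in at least one of the fields `ℚ(√d)`, `d ∈ D`. -/
def inertPrimes (D : Finset ℕ) : Set ℕ :=
  {p | ∃ d ∈ D, IsInertPrime p d}

/-- `X n` has a primitive odd order divisor from the set of primes `R`: there is `p ∈ R` with
`v_p (X n)` odd and `v_p (X i) = 0` for all earlier terms `X i`, `1 ≤ i < n`.  (For a prime `p`,
the condition `¬ p ∣ X i` is `v_p (X i) = 0` with the convention `v_p 0 = ∞`.) -/
def HasPrimitiveOddOrderDivisor (R : Set ℕ) (X : ℕ → ℕ) (n : ℕ) : Prop :=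
  ∃ p ∈ R, p.Prime ∧ Odd (padicValNat p (X n)) ∧ ∀ i, 1 ≤ i → i < n → ¬ p ∣ X i

/-- The sum of `p ^ (-t)` over the primes `p` in `S`. -/
noncomputable def primeZetaSum (S : Set ℕ) (t : ℝ) : ℝ :=
  ∑' p : {p : ℕ // p.Prime ∧ p ∈ S}, (p : ℝ) ^ (-t)

/-- The lower Dirichlet density of the set of primes in `S`: the limit inferior, as `t → 1⁺`, of
the quotient (which lies in `[0, 1]`) of the sum of `p ^ (-t)` over the primes in `S` by that over
all primes.  It equals the Dirichlet density whenever the latter exists. -/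
noncomputable def lowerDirichletDensity (S : Set ℕ) : ℝ :=
  Filter.liminf (fun t : ℝ => primeZetaSum S t / primeZetaSum Set.univ t)
    (nhdsWithin 1 (Set.Ioi 1))

/-- The curve `y² = x³ + 7x² + 2x` over `ℚ`. -/
def curveE : WeierstrassCurve.Affine ℚ where
  a₁ := 0
  a₂ := 7
  a₃ := 0
  a₄ := 2
  a₆ := 0

/-- The point `(-2, 4)` on `y² = x³ + 7x² + 2x`. -/
def pointP : curveE.Point :=
  .some (-2) 4 (by
    rw [WeierstrassCurve.Affine.nonsingular_iff, WeierstrassCurve.Affine.equation_iff]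
    norm_num [curveE])

/-! Write W_n for `edsZ n`: the value at P of the n-th division polynomial, divided by 2^((n²-1)/4)
for odd n and by 2^(n²/4+2) for even n. The rescaling makes W_2 = 1 and leaves an elliptic
recurrence with integral coefficients (`edsZ_elliptic`), so W is an integer sequence, and B_n =
|W_n| for odd n (`ellDivSeq_pointP_of_odd`).

Each d in D is a prime congruent to 1 mod 4. Let s be an odd prime with W_s a nonresidue mod d. Then
|W_s| is a nonresidue too, since -1 is a square mod d, so some prime p with (p/d) = -1 divides B_s
to an odd power. By reciprocity d is a nonresidue mod p, hence p is inert in ℚ(√d). Moreover p is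
primitive: the index of the first term divisible by p divides s and is not 1
(`exists_primitive_divisor_of_legendreSym`, `isInertPrime_of_legendreSym`).

It remains to see when (W_s/d) = -1. Let r be the index of the first term divisible by d; it is even
for all five d. For odd s the recurrence gives W_{s+2r} W_s ≡ -W_{r+1} W_{r-1} W_{s+r}² mod d, and
-W_{r+1} W_{r-1} is a nonzero square mod d in all five cases. So (W_s/d) depends only on s mod 2r
(`legendreSym_edsZ_mod`) and is read off a finite table. The resulting tests have moduli 8, 18, 38,
42, 66, with least common multiple 105336. Of the 25920 invertible classes at most 1152, a
proportion 2/45, escape all five tests, and Dirichlet's theorem turns the remaining 43/45 into a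
density. -/

/-! ### Dirichlet density of primes in residue classes. -/

theorem summable_indicator_rpow (S : Set ℕ) {x : ℝ} (hx : 1 < x) :
    Summable (S.indicator fun n : ℕ => (n : ℝ) ^ (-x)) :=
  (Real.summable_nat_rpow.2 (by linarith)).indicator S

theorem primeZetaSum_eq_tsum_indicator (S : Set ℕ) (x : ℝ) :
    primeZetaSum S x = ∑' n, {p : ℕ | p.Prime ∧ p ∈ S}.indicator (fun n : ℕ => (n : ℝ) ^ (-x)) n :=
  tsum_subtype {p : ℕ | p.Prime ∧ p ∈ S} (fun n : ℕ => (n : ℝ) ^ (-x))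

open Complex LSeries ArithmeticFunction.vonMangoldt in
-- The logarithmic form of Dirichlet's theorem. The derivative of the prime sum is minus the
-- Dirichlet series of log p over the class. Up to the convergent contribution of higher prime
-- powers this is the series of Λ over the class, which is 1/(φ(q)(x-1)) plus a function continuous
-- on [1, 2]. Integrating back from x = 2 leaves a bounded error.
theorem exists_abs_primeZetaSum_sub_log_le {q : ℕ} [NeZero q] {a : ZMod q} (ha : IsUnit a) :
    ∃ C : ℝ, ∀ x ∈ Set.Ioc (1 : ℝ) 2,
      |primeZetaSum {p | (p : ZMod q) = a} x - (q.totient : ℝ)⁻¹ * -Real.log (x - 1)| ≤ C := by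
  classical
  set f : ℕ → ℂ := {n : ℕ | n.Prime ∧ (n : ZMod q) = a}.indicator 1 with hf
  set g : ℕ → ℝ := fun n => if n.Prime then 0 else residueClass a n with hg
  have hfabs : abscissaOfAbsConv f ≤ 1 := by
    refine abscissaOfAbsConv_le_one_of_isBigO_one (Asymptotics.isBigO_of_le _ fun n => ?_)
    rw [hf, Set.indicator_apply]
    split_ifs <;> simp
  have habs {x : ℝ} (hx : 1 < x) : abscissaOfAbsConv f < ((x : ℂ).re : EReal) :=
    hfabs.trans_lt (by rw [ofReal_re]; exact_mod_cast hx)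
  have hF {x : ℝ} (hx : 1 < x) :
      primeZetaSum {p | (p : ZMod q) = a} x = (LSeries f x).re := by
    have : ((primeZetaSum {p | (p : ZMod q) = a} x : ℝ) : ℂ) = LSeries f x := by
      rw [primeZetaSum_eq_tsum_indicator, ofReal_tsum, LSeries]
      refine tsum_congr fun n => ?_
      rw [term_def, hf, Set.indicator_apply, Set.indicator_apply]
      simp only [Set.mem_ofPred_eq, Pi.one_apply]
      by_cases h : n.Prime ∧ (n : ZMod q) = a
      · rw [if_pos h, if_neg h.1.ne_zero, if_pos h, ofReal_cpow n.cast_nonneg]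
        simp [cpow_neg]
      · rw [if_neg h, if_neg h]; simp
    rw [← this, ofReal_re]
  have hsplit (n : ℕ) : (residueClass a n : ℂ) = logMul f n + (g n : ℂ) := by
    simp only [logMul, hf, hg, residueClass, Set.indicator_apply, Set.mem_ofPred_eq]
    by_cases hn : n.Prime
    · by_cases hna : (n : ZMod q) = a
      · simp [hn, hna, ArithmeticFunction.vonMangoldt_apply_prime hn, natCast_log]
      · simp [hn, hna]
    · simp [hn]
  have hgnn (n : ℕ) : 0 ≤ g n / n := by
    have := residueClass_nonneg a n
    simp only [hg]; split_ifs <;> positivity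
  have hgs := summable_residueClass_non_primes_div a
  have hterm {x : ℝ} (hx : 1 < x) (n : ℕ) : ‖term (fun n => (g n : ℂ)) x n‖ ≤ g n / n := by
    rcases eq_or_ne n 0 with rfl | hn
    · simp
    · have hn' : (1 : ℝ) ≤ n := by exact_mod_cast Nat.one_le_iff_ne_zero.2 hn
      have h0 : 0 ≤ g n := by
        have := residueClass_nonneg a n
        simp only [hg]; split_ifs <;> positivity
      rw [term_of_ne_zero hn, norm_div, norm_natCast_cpow_of_pos (by omega), ofReal_re,
        norm_real, Real.norm_of_nonneg h0]
      refine div_le_div_of_nonneg_left h0 (by linarith) ?_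
      conv_lhs => rw [← Real.rpow_one (n : ℝ)]
      exact Real.rpow_le_rpow_of_exponent_le hn' hx.le
  have hgL {x : ℝ} (hx : 1 < x) : LSeriesSummable (fun n => (g n : ℂ)) x :=
    Summable.of_norm_bounded hgs (hterm hx)
  have hgb {x : ℝ} (hx : 1 < x) : ‖LSeries (fun n => (g n : ℂ)) x‖ ≤ ∑' n, g n / n :=
    tsum_of_norm_bounded hgs.hasSum (hterm hx)
  have hcont : ContinuousOn (fun x : ℝ ↦ LFunctionResidueClassAux a x) (Set.Icc 1 2) :=
    (continuousOn_LFunctionResidueClassAux a).comp continuous_ofReal.continuousOn fun x hx ↦ by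
      simpa using hx.1
  obtain ⟨C, hC⟩ := isCompact_Icc.exists_bound_of_continuousOn hcont
  set B := C + ∑' n, g n / n with hB
  -- `D` is the quantity to be bounded; in `D'` the pole at 1 cancels.
  let D : ℝ → ℝ := fun x => (LSeries f x).re + (q.totient : ℝ)⁻¹ * Real.log (x - 1)
  let D' : ℝ → ℝ := fun x => (-LSeries (logMul f) x).re + (q.totient : ℝ)⁻¹ * (1 / (x - 1))
  have hD {x : ℝ} (hx : 1 < x) : HasDerivAt D (D' x) x := by
    refine (LSeries_hasDerivAt (habs hx)).real_of_complex.add ?_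
    exact ((((hasDerivAt_id x).sub_const 1).log (by simpa using sub_ne_zero.2 hx.ne')).const_mul _)
  have hD' {x : ℝ} (hx : x ∈ Set.Ioc (1 : ℝ) 2) : ‖D' x‖ ≤ B := by
    have hlog : LSeriesSummable (logMul f) x := by
      refine LSeriesSummable_of_abscissaOfAbsConv_lt_re ?_
      rw [abscissaOfAbsConv_logMul]; exact habs hx.1
    have e₁ : LSeries (fun n => (residueClass a n : ℂ)) x =
        LSeries (logMul f) x + LSeries (fun n => (g n : ℂ)) x := by
      rw [← LSeries_add hlog (hgL hx.1)]
      exact LSeries_congr (fun {n} _ => hsplit n) _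
    have e₂ := eqOn_LFunctionResidueClassAux ha (show (x : ℂ) ∈ {s : ℂ | 1 < s.re} by
      simpa using hx.1)
    have e₃ : ((D' x : ℝ) : ℝ) =
        (LSeries (fun n => (g n : ℂ)) x - LFunctionResidueClassAux a x).re := by
      rw [e₂]
      simp only [e₁, D']
      have : ((q.totient : ℂ)⁻¹ / ((x : ℂ) - 1)).re = (q.totient : ℝ)⁻¹ * (1 / (x - 1)) := by
        rw [← ofReal_natCast, ← ofReal_one, ← ofReal_sub, ← ofReal_inv, ← ofReal_div, ofReal_re]
        ring
      rw [sub_re, sub_re, add_re, this, neg_re]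
      ring
    rw [e₃, Real.norm_eq_abs]
    refine (abs_re_le_norm _).trans ((norm_sub_le _ _).trans ?_)
    rw [hB, add_comm]
    exact add_le_add (hC x ⟨hx.1.le, hx.2⟩) (hgb hx.1)
  refine ⟨B + |D 2|, fun x hx => ?_⟩
  have hmv := (convex_Ioc (1 : ℝ) 2).norm_image_sub_le_of_norm_hasDerivWithin_le
    (fun y hy => (hD hy.1).hasDerivWithinAt) (fun y hy => hD' hy)
    (show (2 : ℝ) ∈ Set.Ioc (1 : ℝ) 2 by constructor <;> norm_num) hx
  have hB0 : 0 ≤ B := (norm_nonneg _).trans (hD' hx)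
  have hx2 : ‖x - 2‖ ≤ 1 := by
    rw [Real.norm_eq_abs, abs_le]; constructor <;> linarith [hx.1, hx.2]
  have h1 : |D x - D 2| ≤ B := hmv.trans (by nlinarith)
  rw [hF hx.1]
  have h2 : (LSeries f x).re - (q.totient : ℝ)⁻¹ * -Real.log (x - 1) = (D x - D 2) + D 2 := by
    simp only [D]; ring
  rw [h2]
  exact (abs_add_le _ _).trans (by linarith)

theorem primeZetaSum_nonneg (S : Set ℕ) (x : ℝ) : 0 ≤ primeZetaSum S x :=
  tsum_nonneg fun _ => by positivity

theorem primeZetaSum_mono {S T : Set ℕ} (h : S ⊆ T) {x : ℝ} (hx : 1 < x) :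
    primeZetaSum S x ≤ primeZetaSum T x := by
  classical
  rw [primeZetaSum_eq_tsum_indicator, primeZetaSum_eq_tsum_indicator]
  refine Summable.tsum_le_tsum (fun n => ?_) (summable_indicator_rpow _ hx)
    (summable_indicator_rpow _ hx)
  have h0 : (0 : ℝ) ≤ (n : ℝ) ^ (-x) := by positivity
  simp only [Set.indicator_apply, Set.mem_ofPred_eq]
  by_cases hn : n.Prime ∧ n ∈ S
  · rw [if_pos hn, if_pos ⟨hn.1, h hn.2⟩]
  · rw [if_neg hn]; split_ifs <;> simp [h0]

theorem sum_primeZetaSum_le {q : ℕ} (A : Finset (ZMod q)) {S : Set ℕ}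
    (hS : ∀ p : ℕ, p.Prime → (p : ZMod q) ∈ A → p ∈ S) {x : ℝ} (hx : 1 < x) :
    ∑ a ∈ A, primeZetaSum {p | (p : ZMod q) = a} x ≤ primeZetaSum S x := by
  classical
  simp only [primeZetaSum_eq_tsum_indicator]
  rw [← Summable.tsum_finsetSum fun a _ => summable_indicator_rpow _ hx]
  refine Summable.tsum_le_tsum (fun n => ?_)
    (summable_sum fun a _ => summable_indicator_rpow _ hx) (summable_indicator_rpow _ hx)
  have h0 : (0 : ℝ) ≤ (n : ℝ) ^ (-x) := by positivity
  simp only [Set.indicator_apply, Set.mem_ofPred_eq]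
  by_cases hn : n.Prime
  · simp only [hn, true_and]
    rw [Finset.sum_ite_eq]
    by_cases hA : (n : ZMod q) ∈ A
    · rw [if_pos hA, if_pos (hS n hn hA)]
    · rw [if_neg hA]; split_ifs <;> simp [h0]
  · simp [hn]

open Filter Topology in
/-- A set containing all primes of the invertible residue classes `A` modulo `q` has lower
Dirichlet density at least `|A| / φ(q)`. -/
theorem card_div_totient_le_lowerDirichletDensity {q : ℕ} [NeZero q] (A : Finset (ZMod q))
    (hA : ∀ a ∈ A, IsUnit a) {S : Set ℕ} (hS : ∀ p : ℕ, p.Prime → (p : ZMod q) ∈ A → p ∈ S) :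
    (A.card : ℝ) / q.totient ≤ lowerDirichletDensity S := by
  have hex : ∀ a : ZMod q, ∃ C : ℝ, a ∈ A → ∀ x ∈ Set.Ioc (1 : ℝ) 2,
      |primeZetaSum {p | (p : ZMod q) = a} x - (q.totient : ℝ)⁻¹ * -Real.log (x - 1)| ≤ C := by
    intro a
    by_cases ha : a ∈ A
    · obtain ⟨C, hC⟩ := exists_abs_primeZetaSum_sub_log_le (hA a ha)
      exact ⟨C, fun _ => hC⟩
    · exact ⟨0, fun h => absurd h ha⟩
  choose C hC using hex
  -- The denominator is the same estimate for modulus 1, whose only class contains all primes.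
  obtain ⟨C₁, hC₁⟩ := exists_abs_primeZetaSum_sub_log_le (q := 1) (a := 0) (isUnit_of_subsingleton 0)
  have huniv : {p : ℕ | (p : ZMod 1) = 0} = Set.univ := by
    ext p; simp [Subsingleton.elim (p : ZMod 1) 0]
  rw [huniv] at hC₁
  simp only [Nat.totient_one, Nat.cast_one, inv_one, one_mul] at hC₁
  set κ : ℝ := (A.card : ℝ) / q.totient with hκ
  set K : ℝ := ∑ a ∈ A, C a with hK
  have hmem : ∀ᶠ x : ℝ in 𝓝[>] 1, x ∈ Set.Ioc (1 : ℝ) 2 :=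
    Ioc_mem_nhdsGT (by norm_num)
  have hL : Tendsto (fun x : ℝ => -Real.log (x - 1)) (𝓝[>] 1) atTop := by
    refine tendsto_neg_atBot_atTop.comp (Real.tendsto_log_nhdsGT_zero.comp ?_)
    refine tendsto_nhdsWithin_iff.2 ⟨?_, ?_⟩
    · refine tendsto_nhdsWithin_of_tendsto_nhds ?_
      have : Tendsto (fun x : ℝ => x - 1) (𝓝 1) (𝓝 (1 - 1)) := tendsto_id.sub_const 1
      simpa using this
    · filter_upwards [self_mem_nhdsWithin] with x hx
      exact sub_pos.2 (Set.mem_Ioi.1 hx)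
  have hlow : Tendsto (fun x : ℝ => (κ * -Real.log (x - 1) - K) / (-Real.log (x - 1) + C₁))
      (𝓝[>] 1) (𝓝 κ) := by
    have h1 : Tendsto (fun y : ℝ => (κ * y - K) / (y + C₁)) atTop (𝓝 κ) := by
      have hy : Tendsto (fun y : ℝ => y⁻¹) atTop (𝓝 0) := tendsto_inv_atTop_zero
      have h2 : Tendsto (fun y : ℝ => (κ - K * y⁻¹) / (1 + C₁ * y⁻¹)) atTop
          (𝓝 ((κ - K * 0) / (1 + C₁ * 0))) :=
        (tendsto_const_nhds.sub (hy.const_mul K)).div (tendsto_const_nhds.add (hy.const_mul C₁))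
          (by norm_num)
      simp only [mul_zero, sub_zero, add_zero, div_one] at h2
      refine h2.congr' ?_
      filter_upwards [eventually_gt_atTop 0] with y hy0
      have : y ≠ 0 := hy0.ne'
      rw [← mul_div_mul_right _ _ this]
      congr 1 <;> field_simp
    exact h1.comp hL
  have hle : ∀ᶠ x : ℝ in 𝓝[>] 1, (κ * -Real.log (x - 1) - K) / (-Real.log (x - 1) + C₁) ≤
      primeZetaSum S x / primeZetaSum Set.univ x := by
    filter_upwards [hmem, hL.eventually_gt_atTop C₁, hL.eventually_gt_atTop (-C₁)] with x hx h1 h2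
    have hsum := sum_primeZetaSum_le A hS hx.1
    have hlb : κ * -Real.log (x - 1) - K ≤ primeZetaSum S x := by
      refine le_trans ?_ hsum
      have : ∀ a ∈ A, (q.totient : ℝ)⁻¹ * -Real.log (x - 1) - C a ≤
          primeZetaSum {p | (p : ZMod q) = a} x := fun a ha => by
        have := (abs_le.1 (hC a ha x hx)).1
        linarith
      refine le_trans (le_of_eq ?_) (Finset.sum_le_sum this)
      rw [Finset.sum_sub_distrib, Finset.sum_const, nsmul_eq_mul, hκ, hK]
      ring
    have hub := abs_le.1 (hC₁ x hx)
    have hpos : 0 < primeZetaSum Set.univ x := by linarith [hub.1]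
    calc _ ≤ primeZetaSum S x / (-Real.log (x - 1) + C₁) :=
          div_le_div_of_nonneg_right hlb (by linarith)
      _ ≤ _ := div_le_div_of_nonneg_left (primeZetaSum_nonneg S x) hpos (by linarith [hub.2])
  -- Comparing real liminfs requires boundedness; here the quotient is at most 1.
  have hub : IsBoundedUnder (· ≤ ·) (𝓝[>] (1 : ℝ))
      (fun x => primeZetaSum S x / primeZetaSum Set.univ x) := by
    refine isBoundedUnder_of_eventually_le (a := 1) ?_
    filter_upwards [hmem] with x hx
    exact div_le_one_of_le₀ (primeZetaSum_mono (Set.subset_univ S) hx.1) (primeZetaSum_nonneg _ _)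
  rw [← hlow.liminf_eq, lowerDirichletDensity]
  exact liminf_le_liminf hle hlow.isBoundedUnder_ge hub.isCoboundedUnder_ge

/-! ### Addition formulas on the curve and infinite order of P. -/

open WeierstrassCurve.Affine in
theorem curveE_equation {x y : ℚ} (h : curveE.Nonsingular x y) :
    y ^ 2 = x ^ 3 + 7 * x ^ 2 + 2 * x := by
  have := (equation_iff x y).1 h.1
  simp only [curveE] at this
  linarith

/-- The `x`-coordinate of a point (`0` at infinity). -/
def xCoord {W : WeierstrassCurve.Affine ℚ} : W.Point → ℚ
  | .zero => 0
  | .some x _ _ => x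

open WeierstrassCurve.Affine in
theorem xCoord_ne_of_ne {A B : curveE.Point} (hA : A ≠ 0) (hB : B ≠ 0) (h₁ : A ≠ B)
    (h₂ : A ≠ -B) : xCoord A ≠ xCoord B := by
  rcases A with _ | ⟨a, y, h⟩
  · exact absurd rfl hA
  rcases B with _ | ⟨b, z, k⟩
  · exact absurd rfl hB
  intro hab
  change a = b at hab
  subst hab
  rcases Y_eq_of_X_eq h.1 k.1 rfl with e | e
  · subst e; exact h₁ rfl
  · apply h₂
    rw [Point.neg_some]
    subst e; rfl

open WeierstrassCurve.Affine in
-- With a, b the two x-coordinates, the right side is a²b² + b²c² + c²a² - 2abc(a+b+c) - 28abc -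
-- 4(ab+bc+ca) + 4, which is symmetric in a, b, c. This symmetry drives the induction in `edsQ_rel`.
theorem xCoord_add_mul_xCoord_sub {A B : curveE.Point} (hA : A ≠ 0) (hB : B ≠ 0)
    (hx : xCoord A ≠ xCoord B) (c : ℚ) :
    (xCoord (A + B) - c) * (xCoord (A - B) - c) * (xCoord A - xCoord B) ^ 2 =
      (xCoord A * xCoord B - 2) ^ 2 - 2 * c * (xCoord A * xCoord B * (xCoord A + xCoord B) +
        14 * (xCoord A * xCoord B) + 2 * (xCoord A + xCoord B)) +
        c ^ 2 * (xCoord A - xCoord B) ^ 2 := by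
  rcases A with _ | ⟨a, y, h⟩
  · exact absurd rfl hA
  rcases B with _ | ⟨b, z, k⟩
  · exact absurd rfl hB
  change a ≠ b at hx
  have e₁ := curveE_equation h
  have e₂ := curveE_equation k
  rw [sub_eq_add_neg (Point.some a y h), Point.neg_some, Point.add_of_X_ne hx,
    Point.add_of_X_ne hx]
  simp only [xCoord, addX, slope_of_X_ne hx, negY]
  simp only [curveE]
  have hab : a - b ≠ 0 := sub_ne_zero.2 hx
  have hy : y ^ 4 = (a ^ 3 + 7 * a ^ 2 + 2 * a) ^ 2 := by rw [← e₁]; ring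
  have hz : z ^ 4 = (b ^ 3 + 7 * b ^ 2 + 2 * b) ^ 2 := by rw [← e₂]; ring
  field_simp
  ring_nf
  rw [hy, hz, e₁, e₂]
  ring

open WeierstrassCurve.Affine in
theorem xCoord_two_nsmul {A : curveE.Point} (hA : A ≠ 0)
    (h0 : xCoord A ^ 3 + 7 * xCoord A ^ 2 + 2 * xCoord A ≠ 0) :
    (2 • A) ≠ 0 ∧ xCoord (2 • A) * (4 * (xCoord A ^ 3 + 7 * xCoord A ^ 2 + 2 * xCoord A)) =
      (xCoord A ^ 2 - 2) ^ 2 := by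
  rcases A with _ | ⟨a, y, h⟩
  · exact absurd rfl hA
  change a ^ 3 + 7 * a ^ 2 + 2 * a ≠ 0 at h0
  have e₁ := curveE_equation h
  have hy0 : y ≠ 0 := by rintro rfl; apply h0; rw [← e₁]; ring
  have hy : y ≠ negY curveE a y := by
    simp only [negY]; simp only [curveE]
    intro e; apply hy0; linarith
  rw [two_nsmul, Point.add_self_of_Y_ne hy]
  refine ⟨Point.some_ne_zero _, ?_⟩
  have hs : curveE.slope a a y y * (2 * y) = 3 * a ^ 2 + 14 * a + 2 := by
    rw [slope_of_Y_ne rfl hy, show y - negY curveE a y = 2 * y by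
      simp only [negY]; simp only [curveE]; ring, div_mul_cancel₀ _ (by simpa using hy0)]
    simp only [curveE]; ring
  simp only [xCoord, addX]
  generalize curveE.slope a a y y = l at hs
  simp only [curveE]
  rw [← e₁]
  linear_combination (2 * y * l + 3 * a ^ 2 + 14 * a + 2) * hs - 4 * (7 + 2 * a) * e₁

/-- When |x|₂ > 1 the leading terms of the duplication formula dominate, and x(2A) has the 2-adic
size of x⁴/(4x³) = x/4. -/
theorem padicNorm_xCoord_two_nsmul {A : curveE.Point} (hA : A ≠ 0)
    (h : 1 < padicNorm 2 (xCoord A)) :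
    2 • A ≠ 0 ∧ padicNorm 2 (xCoord (2 • A)) = 4 * padicNorm 2 (xCoord A) := by
  set x := xCoord A with hx
  have n2 : padicNorm 2 (2 : ℚ) = 1 / 2 := by
    have := padicNorm.padicNorm_p (p := 2) (by norm_num)
    simpa using this
  have n4 : padicNorm 2 (4 : ℚ) = 1 / 4 := by
    rw [show (4 : ℚ) = 2 * 2 by norm_num, padicNorm.mul, n2]; norm_num
  have hsq : padicNorm 2 (x ^ 2) = padicNorm 2 x ^ 2 := by rw [pow_two, padicNorm.mul, pow_two]
  have hlt : padicNorm 2 x < padicNorm 2 x ^ 2 := by nlinarith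
  have e₁ : padicNorm 2 (x ^ 2 - 2) = padicNorm 2 x ^ 2 := by
    have hne : padicNorm 2 (x ^ 2) ≠ padicNorm 2 (-2 : ℚ) := by
      rw [hsq, padicNorm.neg, n2]; nlinarith
    rw [sub_eq_add_neg, padicNorm.add_eq_max_of_ne hne, hsq, padicNorm.neg, n2]
    exact max_eq_left (by linarith)
  have h7 : padicNorm 2 (7 * x + 2) ≤ padicNorm 2 x := by
    refine (padicNorm.nonarchimedean).trans (max_le ?_ (by rw [n2]; linarith))
    rw [padicNorm.mul]
    have : padicNorm 2 (7 : ℚ) ≤ 1 := by exact_mod_cast padicNorm.of_int (p := 2) 7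
    nlinarith
  have e₂ : padicNorm 2 (x ^ 2 + (7 * x + 2)) = padicNorm 2 x ^ 2 := by
    rw [padicNorm.add_eq_max_of_ne (by rw [hsq]; linarith), hsq]
    exact max_eq_left (by linarith)
  have e₃ : padicNorm 2 (x ^ 3 + 7 * x ^ 2 + 2 * x) = padicNorm 2 x ^ 3 := by
    rw [show x ^ 3 + 7 * x ^ 2 + 2 * x = x * (x ^ 2 + (7 * x + 2)) by ring, padicNorm.mul, e₂]
    ring
  have h0 : x ^ 3 + 7 * x ^ 2 + 2 * x ≠ 0 := by
    intro h0
    rw [h0, padicNorm.zero] at e₃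
    have : 0 < padicNorm 2 x ^ 3 := by positivity
    linarith
  obtain ⟨h1, h2⟩ := xCoord_two_nsmul hA h0
  refine ⟨h1, ?_⟩
  have := congrArg (padicNorm 2) h2
  rw [padicNorm.mul, padicNorm.mul, ← hx, e₃, n4, pow_two (x ^ 2 - 2), padicNorm.mul, e₁] at this
  have hp : padicNorm 2 x ^ 3 ≠ 0 := by positivity
  have h3 : padicNorm 2 (xCoord (2 • A)) * padicNorm 2 x ^ 3 =
      (4 * padicNorm 2 x) * padicNorm 2 x ^ 3 := by linarith
  exact mul_right_cancel₀ hp h3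

theorem pointP_ne_zero : pointP ≠ 0 := WeierstrassCurve.Affine.Point.some_ne_zero _

theorem xCoord_pointP : xCoord pointP = -2 := rfl

theorem two_nsmul_pointP : 2 • pointP ≠ 0 ∧ xCoord (2 • pointP) = 1 / 16 := by
  have h := xCoord_two_nsmul pointP_ne_zero (by rw [xCoord_pointP]; norm_num)
  refine ⟨h.1, ?_⟩
  have := h.2
  rw [xCoord_pointP] at this
  linarith

theorem padicNorm_xCoord_two_pow (k : ℕ) :
    2 ^ (k + 1) • pointP ≠ 0 ∧ padicNorm 2 (xCoord (2 ^ (k + 1) • pointP)) = 4 ^ (k + 2) := by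
  induction k with
  | zero =>
    refine ⟨two_nsmul_pointP.1, ?_⟩
    rw [zero_add, pow_one, two_nsmul_pointP.2, one_div, show (16 : ℚ) = 2 * 2 * (2 * 2) by norm_num]
    have n2 : padicNorm 2 (2 : ℚ) = (2 : ℚ)⁻¹ := by
      have := padicNorm.padicNorm_p (p := 2) (by norm_num)
      simpa using this
    have := padicNorm.div (p := 2) 1 (2 * 2 * (2 * 2))
    rw [one_div, padicNorm.mul, padicNorm.mul, n2] at this
    rw [this]; norm_num
  | succ k ih =>
    have h := padicNorm_xCoord_two_nsmul ih.1 (by rw [ih.2]; exact one_lt_pow₀ (by norm_num) (by omega))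
    rw [pow_succ' 2 (k + 1), mul_smul]
    refine ⟨h.1, ?_⟩
    rw [h.2, ih.2]; ring

/-- The points 2^(k+1) • P have x-coordinates of pairwise distinct 2-adic norm, so P has infinitely
many multiples. -/
theorem nsmul_pointP_ne_zero {n : ℕ} (hn : n ≠ 0) : n • pointP ≠ 0 := by
  intro h
  have hfin : IsOfFinAddOrder pointP := isOfFinAddOrder_iff_nsmul_eq_zero.2 ⟨n, by omega, h⟩
  have hf := finite_multiples.2 hfin
  refine Set.infinite_range_of_injective (f := fun k : ℕ => 2 ^ (k + 1) • pointP) ?_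
    (hf.subset ?_)
  · intro i j hij
    have := (padicNorm_xCoord_two_pow i).2
    have hij' : 2 ^ (i + 1) • pointP = 2 ^ (j + 1) • pointP := hij
    rw [hij', (padicNorm_xCoord_two_pow j).2] at this
    have := pow_right_injective₀ (by norm_num : (0 : ℚ) < 4) (by norm_num) this
    omega
  · rintro _ ⟨k, rfl⟩
    exact ⟨_, rfl⟩

/-- The `x`-coordinate of `n • P`. -/
def xMul (n : ℕ) : ℚ := xCoord (n • pointP)

theorem xMul_one : xMul 1 = -2 := by rw [xMul, one_smul, xCoord_pointP]

theorem xMul_two : xMul 2 = 1 / 16 := two_nsmul_pointP.2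

theorem xMul_ne {m n : ℕ} (hm : m ≠ 0) (hn : n ≠ 0) (h : m ≠ n) : xMul m ≠ xMul n := by
  wlog hlt : n < m generalizing m n
  · exact (this hn hm h.symm (by omega)).symm
  refine xCoord_ne_of_ne (nsmul_pointP_ne_zero hm) (nsmul_pointP_ne_zero hn) ?_ ?_
  · intro e
    apply nsmul_pointP_ne_zero (n := m - n) (by omega)
    rw [sub_nsmul _ hlt.le, e, add_neg_cancel]
  · intro e
    apply nsmul_pointP_ne_zero (n := m + n) (by omega)
    rw [add_nsmul, e, neg_add_cancel]

theorem xMul_add_mul_xMul_sub {m n : ℕ} (hn : n ≠ 0) (h : n < m) (c : ℚ) :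
    (xMul (m + n) - c) * (xMul (m - n) - c) * (xMul m - xMul n) ^ 2 =
      (xMul m * xMul n - 2) ^ 2 - 2 * c * (xMul m * xMul n * (xMul m + xMul n) +
        14 * (xMul m * xMul n) + 2 * (xMul m + xMul n)) +
        c ^ 2 * (xMul m - xMul n) ^ 2 := by
  have hm : m ≠ 0 := by omega
  have := xCoord_add_mul_xCoord_sub (nsmul_pointP_ne_zero hm) (nsmul_pointP_ne_zero hn)
    (xMul_ne hm hn (by omega)) c
  rw [← add_nsmul, sub_eq_add_neg (m • pointP), ← sub_nsmul _ h.le] at this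
  exact this

/-! ### The rescaled elliptic sequence and its integrality. -/

/-- The factor in the elliptic relation of the sequence `edsQ`. -/
def edsFactor (m n : ℕ) : ℚ := if m % 2 = 1 ∧ n % 2 = 1 then 32 else 1 / 16

theorem edsFactor_ne_zero (m n : ℕ) : edsFactor m n ≠ 0 := by
  unfold edsFactor; split_ifs <;> norm_num

/-- The elliptic sequence of the point `(-2, 4)`, rescaled by powers of `2`. -/
def edsQ : ℕ → ℚ
  | 0 => 0
  | 1 => 1
  | 2 => 1
  | n + 3 => edsQ (n + 2) ^ 2 * (xMul 1 - xMul (n + 2)) / (edsFactor (n + 2) 1 * edsQ (n + 1))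

theorem edsQ_ne_zero : ∀ {n : ℕ}, n ≠ 0 → edsQ n ≠ 0
  | 0, h => absurd rfl h
  | 1, _ => by norm_num [edsQ]
  | 2, _ => by norm_num [edsQ]
  | n + 3, _ => by
    rw [edsQ]
    have h₁ : edsQ (n + 2) ≠ 0 := edsQ_ne_zero (by omega)
    have h₂ : edsQ (n + 1) ≠ 0 := edsQ_ne_zero (by omega)
    have h₃ : xMul 1 - xMul (n + 2) ≠ 0 := sub_ne_zero.2 (xMul_ne (by omega) (by omega) (by omega))
    exact div_ne_zero (mul_ne_zero (pow_ne_zero 2 h₁) h₃) (mul_ne_zero (edsFactor_ne_zero _ _) h₂)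

theorem edsQ_rel_one {n : ℕ} (hn : n ≠ 0) :
    edsFactor n 1 * edsQ (n + 1) * edsQ (n - 1) = edsQ n ^ 2 * (xMul 1 - xMul n) := by
  rcases n with _ | _ | n
  · exact absurd rfl hn
  · simp [edsQ]
  · have h₂ : edsQ (n + 1) ≠ 0 := edsQ_ne_zero (by omega)
    have := edsFactor_ne_zero (n + 2) 1
    change edsFactor (n + 2) 1 * edsQ (n + 3) * edsQ (n + 1) = _
    rw [edsQ]
    field_simp

/-- A separate base case, since the inductive step of `edsQ_rel` degenerates here because of the
zero term of index 0. Setting two arguments of the symmetric form equal to x_1 = -2 makes it linear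
in x_m, namely 64 (1/16 - x_m) with 1/16 = x_2. -/
theorem edsQ_rel_two {m : ℕ} (h : 2 < m) :
    edsFactor m 2 * edsQ (m + 2) * edsQ (m - 2) =
      edsQ m ^ 2 * edsQ 2 ^ 2 * (xMul 2 - xMul m) := by
  have ha := edsQ_rel_one (n := m + 1) (by omega)
  have hb := edsQ_rel_one (n := m - 1) (by omega)
  have hm := edsQ_rel_one (n := m) (by omega)
  have hK := xMul_add_mul_xMul_sub (m := m) one_ne_zero (by omega) (xMul 1)
  rw [show m - 1 + 1 = m by omega, show m - 1 - 1 = m - 2 by omega] at hb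
  rw [show m + 1 + 1 = m + 2 by omega, show m + 1 - 1 = m by omega] at ha
  rw [xMul_one] at *
  rw [xMul_two]
  have h2 : edsQ 2 = 1 := by simp [edsQ]
  have hf : edsFactor m 2 = 1 / 16 := by simp [edsFactor]
  rw [h2, hf]
  have hu : edsQ m ≠ 0 := edsQ_ne_zero (by omega)
  have hs : edsFactor (m + 1) 1 * edsFactor (m - 1) 1 * edsFactor m 1 ^ 2 = 4 := by
    rcases Nat.mod_two_eq_zero_or_one m with e | e
    · have h1 : (m + 1) % 2 = 1 := by omega
      have h2 : (m - 1) % 2 = 1 := by omega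
      simp [edsFactor, h1, h2, e]; norm_num
    · have h1 : (m + 1) % 2 = 0 := by omega
      have h2 : (m - 1) % 2 = 0 := by omega
      simp [edsFactor, h1, h2, e]; norm_num
  have key : 4 * (edsQ (m + 2) * edsQ (m - 2)) * edsQ m ^ 2 =
      64 * edsQ m ^ 2 * (1 / 16 - xMul m) * edsQ m ^ 2 := by
    calc 4 * (edsQ (m + 2) * edsQ (m - 2)) * edsQ m ^ 2
        = (edsFactor (m + 1) 1 * edsQ (m + 2) * edsQ m) *
          (edsFactor (m - 1) 1 * edsQ m * edsQ (m - 2)) * edsFactor m 1 ^ 2 := by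
            rw [← hs]; ring
      _ = (edsFactor m 1 * edsQ (m + 1) * edsQ (m - 1)) ^ 2 *
          ((-2 - xMul (m + 1)) * (-2 - xMul (m - 1))) := by rw [ha, hb]; ring
      _ = _ := by rw [hm]; linear_combination edsQ m ^ 4 * hK
  have := mul_right_cancel₀ (pow_ne_zero 2 hu) key
  linarith

/-- Put k = j + 2. The relations at (m+k, 1) and (m-k, 1) multiply to an expression in (x_{m+k} -
x_1)(x_{m-k} - x_1). By the symmetry of the three-variable form in x_m, x_k, x_1 it can be exchanged
for (x_{k+1} - x_m)(x_{k-1} - x_m), the desired relation at k+1 times the known one at k-1, which is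
then cancelled. -/
theorem edsQ_rel : ∀ n : ℕ, n ≠ 0 → ∀ m : ℕ, n < m →
    edsFactor m n * edsQ (m + n) * edsQ (m - n) =
      edsQ m ^ 2 * edsQ n ^ 2 * (xMul n - xMul m)
  | 0, h, _, _ => absurd rfl h
  | 1, _, m, h => by
    rw [show edsQ 1 = 1 by simp [edsQ], edsQ_rel_one (by omega)]; ring
  | 2, _, m, h => edsQ_rel_two h
  | j + 3, _, m, h => by
    have h1 := edsQ_rel (j + 2) (by omega) m (by omega)
    have h0 := edsQ_rel (j + 1) (by omega) m (by omega)
    have ha := edsQ_rel_one (n := m + (j + 2)) (by omega)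
    have hb := edsQ_rel_one (n := m - (j + 2)) (by omega)
    have hj := edsQ_rel_one (n := j + 2) (by omega)
    have hK := xMul_add_mul_xMul_sub (m := m) (n := j + 2) (by omega) (by omega) (xMul 1)
    have hL := xMul_add_mul_xMul_sub (m := j + 2) (n := 1) (by omega) (by omega) (xMul m)
    rw [show m - (j + 2) + 1 = m - (j + 1) by omega,
      show m - (j + 2) - 1 = m - (j + 3) by omega] at hb
    rw [show m + (j + 2) + 1 = m + (j + 3) by omega,
      show m + (j + 2) - 1 = m + (j + 1) by omega] at ha
    rw [show j + 2 + 1 = j + 3 by omega, show j + 2 - 1 = j + 1 by omega] at hj hL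
    -- The powers of 2 from the rescaling balance in every parity case.
    have hs : edsFactor m (j + 3) * edsFactor m (j + 1) * edsFactor (j + 2) 1 ^ 2 =
        edsFactor (m + (j + 2)) 1 * edsFactor (m - (j + 2)) 1 * edsFactor m (j + 2) ^ 2 := by
      have e₃ : (j + 3) % 2 = (j + 1) % 2 := by omega
      have e₄ : (m - (j + 2)) % 2 = (m + (j + 2)) % 2 := by omega
      rcases Nat.mod_two_eq_zero_or_one m with e | e <;>
      rcases Nat.mod_two_eq_zero_or_one j with e' | e'
      · have h1 : (m + (j + 2)) % 2 = 0 := by omega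
        have h2 : (j + 1) % 2 = 1 := by omega
        simp [edsFactor, h1, h2, e, e', e₃, e₄]
      · have h1 : (m + (j + 2)) % 2 = 1 := by omega
        have h2 : (j + 1) % 2 = 0 := by omega
        simp [edsFactor, h1, h2, e, e', e₃, e₄]; norm_num
      · have h1 : (m + (j + 2)) % 2 = 1 := by omega
        have h2 : (j + 1) % 2 = 1 := by omega
        simp [edsFactor, h1, h2, e, e', e₃, e₄]
      · have h1 : (m + (j + 2)) % 2 = 0 := by omega
        have h2 : (j + 1) % 2 = 0 := by omega
        simp [edsFactor, h1, h2, e, e', e₃, e₄]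
    have u₁ : edsQ (m + (j + 1)) ≠ 0 := edsQ_ne_zero (by omega)
    have u₂ : edsQ (m - (j + 1)) ≠ 0 := edsQ_ne_zero (by omega)
    have hne : edsFactor m (j + 1) * edsFactor (j + 2) 1 ^ 2 *
        (edsQ (m + (j + 1)) * edsQ (m - (j + 1))) ≠ 0 :=
      mul_ne_zero (mul_ne_zero (edsFactor_ne_zero _ _) (pow_ne_zero 2 (edsFactor_ne_zero _ _)))
        (mul_ne_zero u₁ u₂)
    refine mul_right_cancel₀ hne ?_
    calc edsFactor m (j + 3) * edsQ (m + (j + 3)) * edsQ (m - (j + 3)) *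
          (edsFactor m (j + 1) * edsFactor (j + 2) 1 ^ 2 *
            (edsQ (m + (j + 1)) * edsQ (m - (j + 1))))
        = edsFactor m (j + 3) * edsFactor m (j + 1) * edsFactor (j + 2) 1 ^ 2 *
          (edsQ (m + (j + 3)) * edsQ (m - (j + 3)) *
            (edsQ (m + (j + 1)) * edsQ (m - (j + 1)))) := by ring
      _ = (edsFactor (m + (j + 2)) 1 * edsQ (m + (j + 3)) * edsQ (m + (j + 1))) *
          (edsFactor (m - (j + 2)) 1 * edsQ (m - (j + 1)) * edsQ (m - (j + 3))) *
            edsFactor m (j + 2) ^ 2 := by rw [hs]; ring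
      _ = (edsFactor m (j + 2) * edsQ (m + (j + 2)) * edsQ (m - (j + 2))) ^ 2 *
          ((xMul (m + (j + 2)) - xMul 1) * (xMul (m - (j + 2)) - xMul 1)) := by
            rw [ha, hb]; ring
      _ = edsQ m ^ 4 * edsQ (j + 2) ^ 4 * ((xMul (m + (j + 2)) - xMul 1) *
          (xMul (m - (j + 2)) - xMul 1) * (xMul m - xMul (j + 2)) ^ 2) := by rw [h1]; ring
      _ = edsQ m ^ 4 * (edsQ (j + 2) ^ 2 * (xMul 1 - xMul (j + 2))) ^ 2 *
          ((xMul (j + 3) - xMul m) * (xMul (j + 1) - xMul m)) := by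
            rw [hK]; linear_combination - edsQ m ^ 4 * edsQ (j + 2) ^ 4 * hL
      _ = edsQ m ^ 2 * edsQ (j + 3) ^ 2 * (xMul (j + 3) - xMul m) * edsFactor (j + 2) 1 ^ 2 *
          (edsQ m ^ 2 * edsQ (j + 1) ^ 2 * (xMul (j + 1) - xMul m)) := by rw [← hj]; ring
      _ = _ := by rw [← h0]; ring

/-- The coefficients in the integral form of the elliptic relation. -/
def edsCoeff (m n : ℕ) : ℤ := if m % 2 = 1 ∧ n % 2 = 0 then 512 else 1

/-- Eliminates the x-coordinates by splitting x_n - x_m as (x_1 - x_m) - (x_1 - x_n). `edsCoeff m n`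
is the ratio of `edsFactor m 1` to `edsFactor m n`, which is 32 · 16 = 512 or 1. -/
theorem edsQ_elliptic {m n : ℕ} (hn : n ≠ 0) (h : n < m) :
    edsQ (m + n) * edsQ (m - n) =
      edsCoeff m n * edsQ (m + 1) * edsQ (m - 1) * edsQ n ^ 2 -
        edsCoeff n m * edsQ (n + 1) * edsQ (n - 1) * edsQ m ^ 2 := by
  have h0 := edsQ_rel n hn m h
  have hm := edsQ_rel_one (n := m) (by omega)
  have hn := edsQ_rel_one hn
  refine mul_left_cancel₀ (edsFactor_ne_zero m n) ?_
  have e₁ : edsFactor m n * edsCoeff m n = edsFactor m 1 := by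
    rcases Nat.mod_two_eq_zero_or_one m with e | e <;>
    rcases Nat.mod_two_eq_zero_or_one n with e' | e' <;>
    simp [edsFactor, edsCoeff, e, e']
    norm_num
  have e₂ : edsFactor m n * edsCoeff n m = edsFactor n 1 := by
    rcases Nat.mod_two_eq_zero_or_one m with e | e <;>
    rcases Nat.mod_two_eq_zero_or_one n with e' | e' <;>
    simp [edsFactor, edsCoeff, e, e']
    norm_num
  linear_combination h0 - edsQ n ^ 2 * hm + edsQ m ^ 2 * hn -
    edsQ (m + 1) * edsQ (m - 1) * edsQ n ^ 2 * e₁ + edsQ (n + 1) * edsQ (n - 1) * edsQ m ^ 2 * e₂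

theorem edsQ_three : edsQ 3 = -33 := by
  have := edsQ_rel_one (n := 2) (by omega)
  norm_num [edsQ, edsFactor, xMul_one, xMul_two] at this ⊢

theorem edsQ_four : edsQ 4 = -50 := by
  have h := edsQ_rel_one (n := 3) (by omega)
  -- With c = 0 the formula gives the product x_3 x_1, hence x_3.
  have hK := xMul_add_mul_xMul_sub (m := 2) (n := 1) (by omega) (by omega) 0
  norm_num [xMul_one, xMul_two] at hK
  have h3 : xMul 3 = -578 / 1089 := by linarith
  norm_num [edsQ_three, edsFactor, xMul_one, h3, show edsQ 2 = 1 by simp [edsQ]] at h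
  linarith

theorem edsQ_odd {k : ℕ} (hk : 2 ≤ k) :
    edsQ (2 * k + 1) = edsCoeff (k + 1) k * edsQ (k + 2) * edsQ k ^ 3 -
      edsCoeff k (k + 1) * edsQ (k - 1) * edsQ (k + 1) ^ 3 := by
  have := edsQ_elliptic (m := k + 1) (n := k) (by omega) (by omega)
  rw [show k + 1 + k = 2 * k + 1 by omega, show k + 1 - k = 1 by omega, show edsQ 1 = 1 from rfl,
    Nat.add_sub_cancel] at this
  linear_combination this

theorem edsQ_even {k : ℕ} (hk : 3 ≤ k) :
    edsQ (2 * k) = edsQ k * (edsQ (k + 2) * edsQ (k - 1) ^ 2 -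
      edsQ (k - 2) * edsQ (k + 1) ^ 2) := by
  have := edsQ_elliptic (m := k + 1) (n := k - 1) (by omega) (by omega)
  have e₁ : edsCoeff (k + 1) (k - 1) = 1 := by
    rw [edsCoeff, if_neg (by omega)]
  have e₂ : edsCoeff (k - 1) (k + 1) = 1 := by
    rw [edsCoeff, if_neg (by omega)]
  rw [show k + 1 + (k - 1) = 2 * k by omega, show k + 1 - (k - 1) = 2 by omega,
    show edsQ 2 = 1 from rfl, show k - 1 + 1 = k by omega, Nat.add_sub_cancel, e₁, e₂] at this
  linear_combination this

/-- The duplication recurrences need no division because the terms of index 1 and 2 are both 1. -/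
theorem exists_int_eq_edsQ (n : ℕ) : ∃ z : ℤ, (z : ℚ) = edsQ n := by
  induction n using Nat.strong_induction_on with
  | _ n ih =>
    rcases Nat.lt_or_ge n 5 with h | h
    · interval_cases n
      · exact ⟨0, by simp [edsQ]⟩
      · exact ⟨1, by simp [edsQ]⟩
      · exact ⟨1, by simp [edsQ]⟩
      · exact ⟨-33, by rw [edsQ_three]; norm_num⟩
      · exact ⟨-50, by rw [edsQ_four]; norm_num⟩
    · obtain ⟨k, rfl | rfl⟩ := Nat.even_or_odd' n
      · obtain ⟨a, ha⟩ := ih (k - 2) (by omega)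
        obtain ⟨b, hb⟩ := ih (k - 1) (by omega)
        obtain ⟨c, hc⟩ := ih k (by omega)
        obtain ⟨d, hd⟩ := ih (k + 1) (by omega)
        obtain ⟨e, he⟩ := ih (k + 2) (by omega)
        refine ⟨c * (e * b ^ 2 - a * d ^ 2), ?_⟩
        rw [edsQ_even (by omega), ← ha, ← hb, ← hc, ← hd, ← he]
        push_cast; ring
      · obtain ⟨b, hb⟩ := ih (k - 1) (by omega)
        obtain ⟨c, hc⟩ := ih k (by omega)
        obtain ⟨d, hd⟩ := ih (k + 1) (by omega)
        obtain ⟨e, he⟩ := ih (k + 2) (by omega)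
        refine ⟨edsCoeff (k + 1) k * e * c ^ 3 - edsCoeff k (k + 1) * b * d ^ 3, ?_⟩
        rw [edsQ_odd (by omega), ← hb, ← hc, ← hd, ← he]
        push_cast; ring

/-- The integer sequence `edsQ`. -/
noncomputable def edsZ (n : ℕ) : ℤ := (exists_int_eq_edsQ n).choose

theorem coe_edsZ (n : ℕ) : (edsZ n : ℚ) = edsQ n := (exists_int_eq_edsQ n).choose_spec

theorem edsZ_ne_zero {n : ℕ} (hn : n ≠ 0) : edsZ n ≠ 0 := by
  have := edsQ_ne_zero hn
  rw [← coe_edsZ] at this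
  exact_mod_cast this

theorem edsZ_zero : edsZ 0 = 0 := by
  rw [← Int.cast_inj (α := ℚ), coe_edsZ]; simp [edsQ]
theorem edsZ_one : edsZ 1 = 1 := by
  rw [← Int.cast_inj (α := ℚ), coe_edsZ]; simp [edsQ]
theorem edsZ_two : edsZ 2 = 1 := by
  rw [← Int.cast_inj (α := ℚ), coe_edsZ]; simp [edsQ]
theorem edsZ_three : edsZ 3 = -33 := by exact_mod_cast (coe_edsZ 3).trans edsQ_three
theorem edsZ_four : edsZ 4 = -50 := by exact_mod_cast (coe_edsZ 4).trans edsQ_four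

theorem edsZ_elliptic {m n : ℕ} (hn : n ≠ 0) (h : n < m) :
    edsZ (m + n) * edsZ (m - n) =
      edsCoeff m n * edsZ (m + 1) * edsZ (m - 1) * edsZ n ^ 2 -
        edsCoeff n m * edsZ (n + 1) * edsZ (n - 1) * edsZ m ^ 2 := by
  have := edsQ_elliptic hn h
  simp only [← coe_edsZ] at this
  exact_mod_cast this

theorem edsZ_odd {k : ℕ} (hk : 2 ≤ k) :
    edsZ (2 * k + 1) = edsCoeff (k + 1) k * edsZ (k + 2) * edsZ k ^ 3 -
      edsCoeff k (k + 1) * edsZ (k - 1) * edsZ (k + 1) ^ 3 := by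
  have := edsQ_odd hk
  simp only [← coe_edsZ] at this
  exact_mod_cast this

theorem edsZ_even {k : ℕ} (hk : 3 ≤ k) :
    edsZ (2 * k) = edsZ k * (edsZ (k + 2) * edsZ (k - 1) ^ 2 -
      edsZ (k - 2) * edsZ (k + 1) ^ 2) := by
  have := edsQ_even hk
  simp only [← coe_edsZ] at this
  exact_mod_cast this

theorem xMul_mul_edsZ_sq {n : ℕ} (hn : n ≠ 0) :
    xMul n * (edsZ n : ℚ) ^ 2 =
      -2 * (edsZ n : ℚ) ^ 2 - edsFactor n 1 * edsZ (n + 1) * edsZ (n - 1) := by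
  have := edsQ_rel_one hn
  simp only [← coe_edsZ, xMul_one] at this
  linear_combination this

/-! ### Divisibility: first appearance of primes, coprimality of neighbours, parity. -/

theorem edsCoeff_dvd (m n : ℕ) : edsCoeff m n ∣ 512 := by
  unfold edsCoeff; split_ifs <;> norm_num

theorem not_dvd_edsCoeff {p : ℕ} (hp : p.Prime) (h2 : p ≠ 2) (m n : ℕ) :
    ¬ (p : ℤ) ∣ edsCoeff m n := by
  intro h
  have h' : (p : ℤ) ∣ ((2 ^ 9 : ℕ) : ℤ) := by
    have := h.trans (edsCoeff_dvd m n)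
    norm_num; exact this
  have := hp.dvd_of_dvd_pow (Int.natCast_dvd_natCast.1 h')
  exact h2 ((Nat.prime_dvd_prime_iff_eq hp Nat.prime_two).1 this)

/-- If an odd prime divides a term but neither of its neighbours nor any earlier term, then it
divides only terms of an index divisible by that of the given one. -/
theorem dvd_of_dvd_edsZ_of_adjacent {p r : ℕ} (hp : p.Prime) (h2 : p ≠ 2) (hr : r ≠ 0)
    (hdvd : (p : ℤ) ∣ edsZ r) (hlt : ∀ j, j ≠ 0 → j < r → ¬ (p : ℤ) ∣ edsZ j)
    (h₁ : ¬ (p : ℤ) ∣ edsZ (r + 1)) (h₂ : ¬ (p : ℤ) ∣ edsZ (r - 1)) {n : ℕ}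
    (hn : (p : ℤ) ∣ edsZ n) : r ∣ n := by
  have hp' : Prime (p : ℤ) := Nat.prime_iff_prime_int.1 hp
  induction n using Nat.strong_induction_on with
  | _ n ih =>
    rcases Nat.eq_zero_or_pos n with rfl | hpos
    · exact dvd_zero r
    rcases Nat.lt_or_ge n r with h | h
    · exact absurd hn (hlt n (by omega) h)
    obtain ⟨m, rfl⟩ := Nat.exists_eq_add_of_le h
    rw [Nat.dvd_add_right dvd_rfl]
    by_contra hm
    have hmr : m ≠ r := by rintro rfl; exact hm dvd_rfl
    have hm0 : m ≠ 0 := by rintro rfl; exact hm (dvd_zero r)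
    have hmn : ¬ (p : ℤ) ∣ edsZ m := fun h => hm (ih m (by omega) h)
    have hsq : (p : ℤ) ∣ edsZ r ^ 2 := dvd_pow hdvd two_ne_zero
    have main : ∀ a b : ℕ, (p : ℤ) ∣ edsCoeff a b * edsZ (r + 1) * edsZ (r - 1) * edsZ m ^ 2 →
        False := by
      intro a b hd
      rcases hp'.dvd_mul.1 hd with hd | hd
      · rcases hp'.dvd_mul.1 hd with hd | hd
        · rcases hp'.dvd_mul.1 hd with hd | hd
          · exact not_dvd_edsCoeff hp h2 _ _ hd
          · exact h₁ hd
        · exact h₂ hd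
      · exact hmn (hp'.dvd_of_dvd_pow hd)
    rcases Nat.lt_or_gt_of_ne hmr with hlt' | hgt
    · have e := edsZ_elliptic hm0 hlt'
      refine main r m ?_
      rw [show edsCoeff r m * edsZ (r + 1) * edsZ (r - 1) * edsZ m ^ 2 =
        edsZ (r + m) * edsZ (r - m) + edsCoeff m r * edsZ (m + 1) * edsZ (m - 1) * edsZ r ^ 2 by
          linear_combination -e]
      exact dvd_add (hn.mul_right _) (hsq.mul_left _)
    · have e := edsZ_elliptic hr hgt
      refine main r m ?_
      rw [show edsCoeff r m * edsZ (r + 1) * edsZ (r - 1) * edsZ m ^ 2 =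
        edsCoeff m r * edsZ (m + 1) * edsZ (m - 1) * edsZ r ^ 2 - edsZ (r + m) * edsZ (m - r) by
          rw [add_comm r m]; linear_combination e]
      exact dvd_sub (hsq.mul_left _) (hn.mul_right _)

/-- For odd m the relation with n = 2 reads W_{m+2} W_{m-2} = 512 (…) + 33 W_m². -/
theorem edsZ_odd_of_odd {n : ℕ} (hn : Odd n) : Odd (edsZ n) := by
  induction n using Nat.strong_induction_on with
  | _ n ih =>
    rcases Nat.lt_or_ge n 5 with h | h
    · interval_cases n
      · exact absurd hn (by decide)
      · rw [edsZ_one]; decide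
      · exact absurd hn (by decide)
      · rw [edsZ_three]; decide
      · exact absurd hn (by decide)
    · obtain ⟨m, rfl⟩ := Nat.exists_eq_add_of_le' (show 2 ≤ n by omega)
      have hm : Odd m := by rw [Nat.odd_iff] at hn ⊢; omega
      have e := edsZ_elliptic (m := m) (n := 2) (by omega) (by omega)
      have c₁ : edsCoeff m 2 = 512 := by
        rw [edsCoeff, if_pos (by rw [Nat.odd_iff] at hm; omega)]
      have c₂ : edsCoeff 2 m = 1 := by rw [edsCoeff, if_neg (by omega)]
      rw [c₁, c₂, edsZ_three, edsZ_two, show 2 - 1 = 1 by rfl, edsZ_one] at e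
      have hodd : Odd (edsZ (m + 2) * edsZ (m - 2)) := by
        rw [e]
        refine Even.sub_odd ?_ ?_
        · rw [mul_assoc, mul_assoc]; exact Even.mul_right (by decide) _
        · exact Odd.mul (by decide) (ih m (by omega) hm).pow
      exact (Int.odd_mul.1 hodd).1

/-- The primes 3 and 11 first appear at W_3 = -33, whose neighbours 1 and -50 are prime to 33. These
are the exceptional primes in the descent of `not_dvd_edsZ_succ`. -/
theorem not_dvd_edsZ_of_dvd_three {p : ℕ} (hp : p.Prime) (h3 : (p : ℤ) ∣ 33) {n : ℕ}
    (hn : (p : ℤ) ∣ edsZ n) : 3 ∣ n := by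
  have h33 : p ∣ 33 := by exact_mod_cast h3
  have h50 : ¬ p ∣ 50 := fun h => by
    have := Nat.dvd_gcd h33 h
    exact hp.one_lt.ne' (Nat.dvd_one.1 this)
  have h1 : ¬ (p : ℤ) ∣ 1 := fun h => hp.one_lt.ne' (Nat.dvd_one.1 (by exact_mod_cast h))
  refine dvd_of_dvd_edsZ_of_adjacent hp ?_ (by omega) ?_ ?_ ?_ ?_ hn
  · rintro rfl; omega
  · rw [edsZ_three]; exact (dvd_neg).2 h3
  · intro j h0 hj
    interval_cases j
    · exact absurd rfl h0
    · rwa [edsZ_one]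
    · rwa [edsZ_two]
  · rw [edsZ_four, dvd_neg]; exact_mod_cast h50
  · rw [show 3 - 1 = 2 by rfl, edsZ_two]; exact h1

/-- Descent: if p divides W_n and W_{n+1}, the relation at (n-1, 2) shows that p divides 33
W_{n-1}². Either p divides W_{n-1}, and the pair moves down, or p divides 33, and then 3 would
divide both n and n+1. -/
theorem not_dvd_edsZ_succ {p : ℕ} (hp : p.Prime) {n : ℕ} (hn : n ≠ 0)
    (h : (p : ℤ) ∣ edsZ n) : ¬ (p : ℤ) ∣ edsZ (n + 1) := by
  have hp' : Prime (p : ℤ) := Nat.prime_iff_prime_int.1 hp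
  have h1 : ¬ (p : ℤ) ∣ 1 := fun h => hp.one_lt.ne' (Nat.dvd_one.1 (by exact_mod_cast h))
  induction n using Nat.strong_induction_on with
  | _ n ih =>
    intro h'
    rcases Nat.lt_or_ge n 4 with hlt | hge
    · interval_cases n
      · exact hn rfl
      · rw [edsZ_one] at h; exact h1 h
      · rw [edsZ_two] at h; exact h1 h
      · rw [edsZ_three, dvd_neg] at h
        rw [edsZ_four, dvd_neg] at h'
        have a : p ∣ 33 := by exact_mod_cast h
        have b : p ∣ 50 := by exact_mod_cast h'
        exact hp.one_lt.ne' (Nat.dvd_one.1 (Nat.dvd_gcd a b))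
    · have e := edsZ_elliptic (m := n - 1) (n := 2) (by omega) (by omega)
      have c₂ : edsCoeff 2 (n - 1) = 1 := by rw [edsCoeff, if_neg (by omega)]
      rw [c₂, edsZ_three, edsZ_two, show 2 - 1 = 1 by rfl, edsZ_one,
        show n - 1 + 2 = n + 1 by omega, show n - 1 + 1 = n by omega] at e
      have hd : (p : ℤ) ∣ 33 * edsZ (n - 1) ^ 2 := by
        rw [show 33 * edsZ (n - 1) ^ 2 = edsZ (n + 1) * edsZ (n - 1 - 2) -
          edsZ n * (edsCoeff (n - 1) 2 * edsZ (n - 1 - 1)) by linear_combination -e]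
        exact dvd_sub (h'.mul_right _) (h.mul_right _)
      rcases hp'.dvd_mul.1 hd with hd | hd
      · have a := not_dvd_edsZ_of_dvd_three hp hd h
        have b := not_dvd_edsZ_of_dvd_three hp hd h'
        omega
      · refine ih (n - 1) (by omega) (by omega) (hp'.dvd_of_dvd_pow hd) ?_
        rwa [show n - 1 + 1 = n by omega]

theorem dvd_of_dvd_edsZ {p r : ℕ} (hp : p.Prime) (h2 : p ≠ 2) (hr : r ≠ 0)
    (hdvd : (p : ℤ) ∣ edsZ r) (hlt : ∀ j, j ≠ 0 → j < r → ¬ (p : ℤ) ∣ edsZ j)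
    {n : ℕ} (hn : (p : ℤ) ∣ edsZ n) : r ∣ n := by
  have hr1 : r ≠ 1 := by
    rintro rfl
    rw [edsZ_one] at hdvd
    exact hp.one_lt.ne' (Nat.dvd_one.1 (by exact_mod_cast hdvd))
  exact dvd_of_dvd_edsZ_of_adjacent hp h2 hr hdvd hlt (not_dvd_edsZ_succ hp hr hdvd)
    (hlt _ (by omega) (by omega)) hn

/-- An odd prime dividing a term of prime index divides no earlier term. -/
theorem not_dvd_edsZ_of_lt_prime {p s : ℕ} (hp : p.Prime) (h2 : p ≠ 2) (hs : s.Prime)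
    (hdvd : (p : ℤ) ∣ edsZ s) {i : ℕ} (h0 : i ≠ 0) (hi : i < s) : ¬ (p : ℤ) ∣ edsZ i := by
  intro hd
  classical
  have hex : ∃ r, r ≠ 0 ∧ (p : ℤ) ∣ edsZ r := ⟨s, hs.ne_zero, hdvd⟩
  obtain ⟨hr, hdr⟩ := Nat.find_spec hex
  have key : ∀ {n}, (p : ℤ) ∣ edsZ n → Nat.find hex ∣ n := fun hn =>
    dvd_of_dvd_edsZ hp h2 hr hdr (fun j hj hlt h => Nat.find_min hex hlt ⟨hj, h⟩) hn
  rcases (Nat.dvd_prime hs).1 (key hdvd) with h | h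
  · rw [h, edsZ_one] at hdr
    exact hp.one_lt.ne' (Nat.dvd_one.1 (by exact_mod_cast hdr))
  · have := Nat.le_of_dvd (by omega) (key hd)
    omega

/-! ### Comparison with the denominators B_n. -/

theorem den_intCast_div_sq {a b : ℤ} (hb : b ≠ 0) (h : IsCoprime a b) :
    ((a : ℚ) / (b : ℚ) ^ 2).den = b.natAbs ^ 2 := by
  have hc : a.natAbs.Coprime (b ^ 2).natAbs := Int.isCoprime_iff_gcd_eq_one.1 h.pow_right
  have := Rat.den_div_eq_of_coprime (a := a) (b := b ^ 2) (by positivity) hc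
  push_cast at this
  have h' : (((a : ℚ) / (b : ℚ) ^ 2).den : ℤ) = ((b.natAbs ^ 2 : ℕ) : ℤ) := by
    rw [this]; simp
  exact_mod_cast h'

theorem ellDivSeq_pointP {n : ℕ} (hn : n ≠ 0) : ellDivSeq pointP n = Nat.sqrt (xMul n).den := by
  have := nsmul_pointP_ne_zero hn
  unfold ellDivSeq xMul
  generalize n • pointP = A at this
  rcases A with _ | ⟨a, y, h⟩
  · exact absurd rfl this
  · rfl

/-- For odd n, x_n = -2 - 32 W_{n+1} W_{n-1} / W_n², and the fraction is reduced because W_n is odd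
and coprime to its neighbours. -/
theorem ellDivSeq_pointP_of_odd {n : ℕ} (hn : Odd n) :
    ellDivSeq pointP n = (edsZ n).natAbs := by
  have hn0 : n ≠ 0 := by rintro rfl; exact absurd hn (by decide)
  have hz := edsZ_ne_zero hn0
  have hx := xMul_mul_edsZ_sq hn0
  have hf : edsFactor n 1 = 32 := by
    rw [edsFactor, if_pos (by rw [Nat.odd_iff] at hn; omega)]
  rw [hf] at hx
  have hx' : xMul n = ((-2 * edsZ n ^ 2 - 32 * edsZ (n + 1) * edsZ (n - 1) : ℤ) : ℚ) /
      (edsZ n : ℚ) ^ 2 := by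
    rw [eq_div_iff (by exact_mod_cast pow_ne_zero 2 hz), hx]
    push_cast; ring
  have hcop : IsCoprime (-2 * edsZ n ^ 2 - 32 * edsZ (n + 1) * edsZ (n - 1)) (edsZ n) := by
    rw [Int.isCoprime_iff_gcd_eq_one]
    by_contra hg
    obtain ⟨p, hp, hd⟩ := Nat.exists_prime_and_dvd hg
    have hp' : Prime (p : ℤ) := Nat.prime_iff_prime_int.1 hp
    have hd' : (p : ℤ) ∣ Int.gcd (-2 * edsZ n ^ 2 - 32 * edsZ (n + 1) * edsZ (n - 1)) (edsZ n) :=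
      by exact_mod_cast hd
    have d₁ := hd'.trans (Int.gcd_dvd_left _ _)
    have d₂ := hd'.trans (Int.gcd_dvd_right _ _)
    have d₃ : (p : ℤ) ∣ 32 * edsZ (n + 1) * edsZ (n - 1) := by
      have := dvd_sub (d₂.mul_left (-2 * edsZ n)) d₁
      rwa [show -2 * edsZ n * edsZ n - (-2 * edsZ n ^ 2 - 32 * edsZ (n + 1) * edsZ (n - 1)) =
        32 * edsZ (n + 1) * edsZ (n - 1) by ring] at this
    rcases hp'.dvd_mul.1 d₃ with d₃ | d₃
    · rcases hp'.dvd_mul.1 d₃ with d₃ | d₃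
      · have : (p : ℤ) ∣ ((2 ^ 5 : ℕ) : ℤ) := by norm_num; exact d₃
        have h2 := (Nat.prime_dvd_prime_iff_eq hp Nat.prime_two).1
          (hp.dvd_of_dvd_pow (Int.natCast_dvd_natCast.1 this))
        subst h2
        exact Int.not_even_iff_odd.2 (edsZ_odd_of_odd hn) (even_iff_two_dvd.2 d₂)
      · exact not_dvd_edsZ_succ hp hn0 d₂ d₃
    · rcases eq_or_ne n 1 with rfl | h1
      · rw [edsZ_one] at d₂
        exact hp.one_lt.ne' (Nat.dvd_one.1 (by exact_mod_cast d₂))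
      · refine not_dvd_edsZ_succ hp (n := n - 1) (by omega) d₃ ?_
        rwa [show n - 1 + 1 = n by omega]
  rw [ellDivSeq_pointP hn0, hx', den_intCast_div_sq hz hcop, Nat.sqrt_eq']

/-- Primitivity also concerns even indices, where powers of 2 intervene (B_2 = 4 but W_2 = 1). For
odd p it is enough to clear the factor 16 from the formula for x_n. -/
theorem dvd_edsZ_of_dvd_ellDivSeq {p n : ℕ} (hp : p.Prime) (h2 : p ≠ 2) (hn : n ≠ 0)
    (h : p ∣ ellDivSeq pointP n) : (p : ℤ) ∣ edsZ n := by
  have hp' : Prime (p : ℤ) := Nat.prime_iff_prime_int.1 hp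
  have hx := xMul_mul_edsZ_sq hn
  have hne := nsmul_pointP_ne_zero hn
  unfold ellDivSeq at h
  unfold xMul at hx
  generalize n • pointP = A at *
  rcases A with _ | ⟨a, y, hA⟩
  · exact absurd rfl hne
  obtain ⟨hB, u, v, hu, hv, hxa, -⟩ := pointDenominator_spec 7 2 0 (W := curveE) rfl
    (by norm_num [curveE]) rfl (by norm_num [curveE]) (by norm_num [curveE]) a y hA
  generalize pointDenominator (WeierstrassCurve.Affine.Point.some a y hA) = B at *
  change a * _ = _ at hx
  obtain ⟨f, hf, hf'⟩ : ∃ f : ℤ, f ≠ 0 ∧ 16 * edsFactor n 1 = f := by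
    unfold edsFactor
    split_ifs
    · exact ⟨512, by norm_num, by norm_num⟩
    · exact ⟨1, by norm_num, by norm_num⟩
  have hBq : (B : ℚ) ≠ 0 := by exact_mod_cast hB.ne'
  have key : 16 * (u * edsZ n ^ 2) =
      (B : ℤ) ^ 2 * (-32 * edsZ n ^ 2 - f * edsZ (n + 1) * edsZ (n - 1)) := by
    have : (16 : ℚ) * (u * edsZ n ^ 2) =
        (B : ℚ) ^ 2 * (-32 * edsZ n ^ 2 - f * edsZ (n + 1) * edsZ (n - 1)) := by
      rw [← hf']
      have e : (u : ℚ) = a * B ^ 2 := by rw [hxa]; field_simp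
      rw [e]
      linear_combination 16 * (B : ℚ) ^ 2 * hx
    exact_mod_cast this
  have hpB : (p : ℤ) ∣ B := by exact_mod_cast h
  have hd : (p : ℤ) ∣ 16 * (u * edsZ n ^ 2) := by
    rw [key]; exact (dvd_pow hpB two_ne_zero).mul_right _
  rcases hp'.dvd_mul.1 hd with hd | hd
  · have : (p : ℤ) ∣ ((2 ^ 4 : ℕ) : ℤ) := by norm_num; exact hd
    exact absurd ((Nat.prime_dvd_prime_iff_eq hp Nat.prime_two).1
      (hp.dvd_of_dvd_pow (Int.natCast_dvd_natCast.1 this))) h2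
  rcases hp'.dvd_mul.1 hd with hd | hd
  · exact absurd (hu.isUnit_of_dvd' hd hpB) hp'.not_isUnit
  · exact hp'.dvd_of_dvd_pow hd

/-! ### Periodicity of the Legendre symbols. -/

theorem edsZ_cast_eq_of_recurrence {d r : ℕ} (hr : 3 ≤ r) (T : ℕ → ZMod d) (h0 : T 0 = 0)
    (h1 : T 1 = 1) (h2 : T 2 = 1) (h3 : T 3 = -33) (h4 : T 4 = -50)
    (hodd : ∀ k < r, 2 ≤ k → T (2 * k + 1) = edsCoeff (k + 1) k * T (k + 2) * T k ^ 3 -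
      edsCoeff k (k + 1) * T (k - 1) * T (k + 1) ^ 3)
    (heven : ∀ k < r, 3 ≤ k → T (2 * k) = T k * (T (k + 2) * T (k - 1) ^ 2 -
      T (k - 2) * T (k + 1) ^ 2)) {n : ℕ} (hn : n < 2 * r) : (edsZ n : ZMod d) = T n := by
  induction n using Nat.strong_induction_on with
  | _ n ih =>
    rcases Nat.lt_or_ge n 5 with h | h
    · interval_cases n
      · rw [edsZ_zero, h0]; simp
      · rw [edsZ_one, h1]; simp
      · rw [edsZ_two, h2]; simp
      · rw [edsZ_three, h3]; simp
      · rw [edsZ_four, h4]; simp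
    · obtain ⟨k, rfl | rfl⟩ := Nat.even_or_odd' n
      · rw [edsZ_even (by omega), heven k (by omega) (by omega), ← ih (k - 2) (by omega) (by omega),
          ← ih (k - 1) (by omega) (by omega), ← ih k (by omega) (by omega),
          ← ih (k + 1) (by omega) (by omega), ← ih (k + 2) (by omega) (by omega)]
        push_cast; ring
      · rw [edsZ_odd (by omega), hodd k (by omega) (by omega),
          ← ih (k - 1) (by omega) (by omega), ← ih k (by omega) (by omega),
          ← ih (k + 1) (by omega) (by omega), ← ih (k + 2) (by omega) (by omega)]
        push_cast; ring

/-- Modulo d the relation at (s+r, r) loses its first term, since W_r ≡ 0. What remains makes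
W_{s+2r} W_s a square constant times W_{s+r}², and r ∤ s keeps W_s and W_{s+r} nonzero. -/
theorem legendreSym_edsZ_add {d r s : ℕ} [Fact d.Prime] (hr : r ≠ 0) (hdvd : (d : ℤ) ∣ edsZ r)
    (hrank : ∀ n, (d : ℤ) ∣ edsZ n → r ∣ n)
    (hκ : legendreSym d (-(edsCoeff r (r + 1) * edsZ (r + 1) * edsZ (r - 1))) = 1)
    (hs : Odd s) (hrs : ¬ r ∣ s) :
    legendreSym d (edsZ (s + 2 * r)) = legendreSym d (edsZ s) := by
  have hs0 : s ≠ 0 := by rintro rfl; exact absurd hs (by decide)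
  have e := edsZ_elliptic (m := s + r) (n := r) hr (by omega)
  rw [show s + r + r = s + 2 * r by ring, Nat.add_sub_cancel,
    show edsCoeff r (s + r) = edsCoeff r (r + 1) by
      rw [Nat.odd_iff] at hs
      simp only [edsCoeff]
      rw [show (s + r) % 2 = (r + 1) % 2 by omega]] at e
  have hd0 : ((edsZ r : ℤ) : ZMod d) = 0 := (ZMod.intCast_zmod_eq_zero_iff_dvd _ _).2 hdvd
  have hne : ((edsZ s : ℤ) : ZMod d) ≠ 0 := fun h =>
    hrs (hrank s ((ZMod.intCast_zmod_eq_zero_iff_dvd _ _).1 h))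
  have hne' : ((edsZ (s + r) : ℤ) : ZMod d) ≠ 0 := fun h =>
    hrs ((Nat.dvd_add_left dvd_rfl).1 (hrank (s + r) ((ZMod.intCast_zmod_eq_zero_iff_dvd _ _).1 h)))
  have hm : legendreSym d (edsZ (s + 2 * r)) * legendreSym d (edsZ s) = 1 := by
    have h2 : legendreSym d (edsZ (s + r) ^ 2) = 1 := legendreSym.sq_one' d hne'
    refine Eq.trans ?_ (show legendreSym d (-(edsCoeff r (r + 1) * edsZ (r + 1) * edsZ (r - 1))) *
      legendreSym d (edsZ (s + r) ^ 2) = 1 by rw [hκ, h2, one_mul])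
    rw [← legendreSym.mul, e, ← legendreSym.mul]
    simp only [legendreSym]
    congr 1
    push_cast
    rw [hd0]; ring
  have hsq := legendreSym.sq_one d hne
  have : legendreSym d (edsZ (s + 2 * r)) = legendreSym d (edsZ (s + 2 * r)) *
      legendreSym d (edsZ s) * legendreSym d (edsZ s) := by
    rw [mul_assoc, ← pow_two, hsq, mul_one]
  rw [this, hm, one_mul]

theorem legendreSym_edsZ_mod {d r s : ℕ} [Fact d.Prime] (hr : r ≠ 0) (hdvd : (d : ℤ) ∣ edsZ r)
    (hrank : ∀ n, (d : ℤ) ∣ edsZ n → r ∣ n)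
    (hκ : legendreSym d (-(edsCoeff r (r + 1) * edsZ (r + 1) * edsZ (r - 1))) = 1)
    (hs : Odd s) (hrs : ¬ r ∣ s) :
    legendreSym d (edsZ s) = legendreSym d (edsZ (s % (2 * r))) := by
  induction s using Nat.strong_induction_on with
  | _ s ih =>
    rcases Nat.lt_or_ge s (2 * r) with h | h
    · rw [Nat.mod_eq_of_lt h]
    · obtain ⟨t, rfl⟩ := Nat.exists_eq_add_of_le' h
      have ht : Odd t := by rw [Nat.odd_iff] at hs ⊢; omega
      have hrt : ¬ r ∣ t := fun h' => hrs (dvd_add h' (dvd_mul_left _ _))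
      rw [legendreSym_edsZ_add hr hdvd hrank hκ ht hrt, ih t (by omega) ht hrt,
        Nat.add_mod_right]

/-- If the residues of the sequence modulo the prime `d` are given on one period by a table `T`,
the terms of odd index are nonresidues except in the classes `L`. -/
theorem legendreSym_edsZ_eq_neg_one {d r s : ℕ} [Fact d.Prime] (hd2 : d ≠ 2) (hr : 3 ≤ r)
    (T : ℕ → ZMod d) {N : ℕ} (hN : N ∣ 2 * r)
    (L : List ℕ) (hr2 : Even r) (h0 : T 0 = 0)
    (h1 : T 1 = 1) (h2 : T 2 = 1) (h3 : T 3 = -33) (h4 : T 4 = -50)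
    (hodd : ∀ k < r, 2 ≤ k → T (2 * k + 1) = edsCoeff (k + 1) k * T (k + 2) * T k ^ 3 -
      edsCoeff k (k + 1) * T (k - 1) * T (k + 1) ^ 3)
    (heven : ∀ k < r, 3 ≤ k → T (2 * k) = T k * (T (k + 2) * T (k - 1) ^ 2 -
      T (k - 2) * T (k + 1) ^ 2))
    (hne : ∀ j < r, j ≠ 0 → T j ≠ 0) (hTr : T r = 0) (y : ZMod d)
    (hy : y ^ 2 = -(edsCoeff r (r + 1) * T (r + 1) * T (r - 1))) (hy0 : y ≠ 0)
    (hns : ∀ j < 2 * r, j % 2 = 1 → j % N ∉ L → ∀ z : ZMod d, T j ≠ z * z)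
    (hs : Odd s) (hL : s % N ∉ L) : legendreSym d (edsZ s) = -1 := by
  have hrs : ¬ r ∣ s := fun h =>
    Nat.not_even_iff_odd.2 hs (even_iff_two_dvd.2 (hr2.two_dvd.trans h))
  have hT {n : ℕ} (hn : n < 2 * r) : (edsZ n : ZMod d) = T n :=
    edsZ_cast_eq_of_recurrence hr T h0 h1 h2 h3 h4 hodd heven hn
  have hdvd : (d : ℤ) ∣ edsZ r := by
    rw [← ZMod.intCast_zmod_eq_zero_iff_dvd, hT (by omega), hTr]
  have hrank : ∀ n, (d : ℤ) ∣ edsZ n → r ∣ n := fun n hn =>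
    dvd_of_dvd_edsZ Fact.out hd2 (by omega) hdvd (fun j hj hlt h => hne j hlt hj (by
      rw [← hT (by omega), ZMod.intCast_zmod_eq_zero_iff_dvd]; exact h)) hn
  have hκ : legendreSym d (-(edsCoeff r (r + 1) * edsZ (r + 1) * edsZ (r - 1))) = 1 := by
    have e : ((-(edsCoeff r (r + 1) * edsZ (r + 1) * edsZ (r - 1)) : ℤ) : ZMod d) = y ^ 2 := by
      rw [hy]; push_cast
      rw [hT (by omega), hT (by omega)]
    rw [legendreSym.eq_one_iff d (by rw [e]; exact pow_ne_zero 2 hy0), e]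
    exact ⟨y, pow_two y⟩
  rw [legendreSym_edsZ_mod (by omega) hdvd hrank hκ hs hrs, legendreSym.eq_neg_one_iff]
  have hlt : s % (2 * r) < 2 * r := Nat.mod_lt _ (by omega)
  rw [hT hlt]
  rintro ⟨z, hz⟩
  refine hns _ hlt ?_ (by rwa [Nat.mod_mod_of_dvd _ hN]) z hz
  rw [Nat.odd_iff] at hs
  rw [Nat.mod_mul_right_mod]
  exact hs

/-! ### From a nonresidue W_s to a primitive divisor of odd order. -/

/-- A quadratic nonresidue has a nonresidue prime divisor of odd multiplicity. -/
theorem exists_prime_odd_padicValNat {d n : ℕ} [Fact d.Prime] (h : legendreSym d n = -1) :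
    ∃ p : ℕ, p.Prime ∧ Odd (padicValNat p n) ∧ legendreSym d p = -1 := by
  by_contra! hc
  have hn : n ≠ 0 := by
    rintro rfl
    simp at h
  have hprod : legendreSym d n = n.factorization.prod fun p k => legendreSym d p ^ k := by
    conv_lhs => rw [← Nat.prod_factorization_pow_eq_self hn]
    rw [Finsupp.prod, Finsupp.prod]
    push_cast
    refine (map_prod (legendreSym.hom d) (fun p : ℕ => ((p : ℤ) ^ n.factorization p))
      n.factorization.support).trans (Finset.prod_congr rfl fun p _ => ?_)
    exact map_pow (legendreSym.hom d) _ _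
  have h1 : legendreSym d n = 1 := by
    rw [hprod]
    refine Finset.prod_eq_one fun p hp => ?_
    have hpp : p.Prime := Nat.prime_of_mem_primeFactors hp
    have hpn : p ∣ n := Nat.dvd_of_mem_primeFactors hp
    have hne : ((p : ℤ) : ZMod d) ≠ 0 := by
      intro h0
      obtain ⟨m, rfl⟩ := hpn
      rw [Nat.cast_mul, legendreSym.mul, (legendreSym.eq_zero_iff d p).2 h0, zero_mul] at h
      omega
    change legendreSym d p ^ n.factorization p = 1
    rcases legendreSym.eq_one_or_neg_one d hne with e | e
    · rw [e, one_pow]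
    · have hev : ¬ Odd (padicValNat p n) := fun ho => hc p hpp ho e
      rw [e, Nat.factorization_def n hpp]
      exact (Nat.not_odd_iff_even.1 hev).neg_one_pow
  omega

theorem exists_primitive_divisor_of_legendreSym {d s : ℕ} [Fact d.Prime] (hd : d % 4 = 1)
    (hs : s.Prime) (hs2 : s ≠ 2) (h : legendreSym d (edsZ s) = -1) :
    ∃ p : ℕ, p.Prime ∧ legendreSym d p = -1 ∧ p ≠ 2 ∧
      Odd (padicValNat p (ellDivSeq pointP s)) ∧
      ∀ i, 1 ≤ i → i < s → ¬ p ∣ ellDivSeq pointP i := by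
  have hodd := hs.odd_of_ne_two hs2
  -- The sign of W_s is harmless because -1 is a square modulo d.
  have habs : legendreSym d ((edsZ s).natAbs : ℕ) = -1 := by
    rcases Int.natAbs_eq (edsZ s) with e | e
    · rw [← e]; exact h
    · have h1 : legendreSym d (-1) = 1 := by
        rw [legendreSym.at_neg_one (by rintro rfl; omega), ZMod.χ₄_nat_one_mod_four hd]
      rw [← h]
      conv_rhs => rw [e, ← neg_one_mul, legendreSym.mul, h1, one_mul]
  obtain ⟨p, hp, hv, hl⟩ := exists_prime_odd_padicValNat habs
  have hpd : (p : ℤ) ∣ edsZ s := by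
    by_contra hc
    rw [padicValNat.eq_zero_of_not_dvd (fun h' => hc (Int.natCast_dvd.2 h'))] at hv
    exact absurd hv (by decide)
  have hp2 : p ≠ 2 := by
    rintro rfl
    exact Int.not_even_iff_odd.2 (edsZ_odd_of_odd hodd) (even_iff_two_dvd.2 hpd)
  refine ⟨p, hp, hl, hp2, ?_, fun i h1 hi hdi => ?_⟩
  · rw [ellDivSeq_pointP_of_odd hodd]; exact hv
  · exact not_dvd_edsZ_of_lt_prime hp hp2 hs hpd (by omega) hi
      (dvd_edsZ_of_dvd_ellDivSeq hp hp2 (by omega) hdi)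

/-! ### Tables modulo 5, 13, 29, 41, 53. -/

/-- Each table lists W_0, …, W_{2r-1} modulo d, where W_r is the first term of positive index
divisible by d. Outside the listed residue classes every entry of odd index is a nonresidue. The
classes are taken modulo 2r = 8 for d = 5 and modulo r for the other d. -/
def edsTable_five : List ℕ := [0, 1, 1, 2, 0, 2, 4, 1]

def residueClasses_five : List ℕ := [1, 7]

instance : Fact (Nat.Prime 5) := ⟨by norm_num⟩

theorem legendreSym_five {s : ℕ} (hs : Odd s) (h : s % 8 ∉ residueClasses_five) :
    legendreSym 5 (edsZ s) = -1 :=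
  legendreSym_edsZ_eq_neg_one (d := 5) (r := 4) (N := 8) (by decide) (by decide)
    (fun n => ((edsTable_five.getD n 0 : ℕ) : ZMod 5)) (by decide) residueClasses_five
    (by decide) (by decide +kernel) (by decide +kernel) (by decide +kernel) (by decide +kernel)
    (by decide +kernel) (by decide +kernel) (by decide +kernel) (by decide +kernel)
    -- The witness (1, 1, 1, 4, 6 for the five primes) is a square root of -W_{r+1} W_{r-1} modulo
    -- d.
    (by decide +kernel) 1 (by decide +kernel) (by decide) (by decide +kernel) hs h

def edsTable_thirteen : List ℕ := [0, 1, 1, 6, 2, 2, 1, 2, 12, 5, 4, 6, 1, 5, 6, 6, 9, 3, 0, 4,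
    10, 7, 8, 7, 12, 8, 3, 8, 3, 8, 12, 7, 8, 7, 10, 4]

def residueClasses_thirteen : List ℕ := [1, 17]

instance : Fact (Nat.Prime 13) := ⟨by norm_num⟩

theorem legendreSym_thirteen {s : ℕ} (hs : Odd s) (h : s % 18 ∉ residueClasses_thirteen) :
    legendreSym 13 (edsZ s) = -1 :=
  legendreSym_edsZ_eq_neg_one (d := 13) (r := 18) (N := 18) (by decide) (by decide)
    (fun n => ((edsTable_thirteen.getD n 0 : ℕ) : ZMod 13)) (by decide) residueClasses_thirteen
    (by decide) (by decide +kernel) (by decide +kernel) (by decide +kernel) (by decide +kernel)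
    (by decide +kernel) (by decide +kernel) (by decide +kernel) (by decide +kernel)
    (by decide +kernel) 1 (by decide +kernel) (by decide) (by decide +kernel) hs h

def edsTable_twentyNine : List ℕ := [0, 1, 1, 25, 8, 13, 1, 25, 23, 14, 1, 21, 18, 22, 18, 18,
    7, 28, 26, 28, 26, 28, 7, 18, 18, 22, 18, 21, 1, 14, 23, 25, 1, 13, 8, 25, 1, 1, 0, 28, 28,
    4, 21, 16, 28, 4, 6, 15, 28, 8, 11, 7, 11, 11, 22, 1, 3, 1, 3, 1, 22, 11, 11, 7, 11, 8, 28,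
    15, 6, 4, 28, 16, 21, 4, 28, 28]

def residueClasses_twentyNine : List ℕ := [1, 3, 5, 7, 13, 17, 19, 21, 25, 31, 33, 35, 37]

instance : Fact (Nat.Prime 29) := ⟨by norm_num⟩

theorem legendreSym_twentyNine {s : ℕ} (hs : Odd s) (h : s % 38 ∉ residueClasses_twentyNine) :
    legendreSym 29 (edsZ s) = -1 :=
  legendreSym_edsZ_eq_neg_one (d := 29) (r := 38) (N := 38) (by decide) (by decide)
    (fun n => ((edsTable_twentyNine.getD n 0 : ℕ) : ZMod 29)) (by decide) residueClasses_twentyNine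
    (by decide) (by decide +kernel) (by decide +kernel) (by decide +kernel) (by decide +kernel)
    (by decide +kernel) (by decide +kernel) (by decide +kernel) (by decide +kernel)
    (by decide +kernel) 1 (by decide +kernel) (by decide) (by decide +kernel) hs h

def edsTable_fortyOne : List ℕ := [0, 1, 1, 8, 32, 5, 7, 2, 6, 14, 39, 39, 31, 38, 28, 7, 2, 17,
    28, 23, 32, 31, 36, 40, 12, 6, 2, 13, 38, 28, 23, 39, 8, 19, 26, 20, 7, 21, 20, 21, 10, 1,
    0, 25, 23, 2, 9, 20, 11, 5, 22, 27, 33, 32, 16, 30, 13, 28, 9, 22, 7, 18, 5, 37, 8, 10, 29,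
    24, 9, 12, 30, 13, 10, 32, 20, 15, 15, 39, 11, 32, 5, 20, 40, 25]

def residueClasses_fortyOne : List ℕ := [1, 3, 5, 7, 11, 19, 21, 23, 31, 35, 37, 39, 41]

instance : Fact (Nat.Prime 41) := ⟨by norm_num⟩

theorem legendreSym_fortyOne {s : ℕ} (hs : Odd s) (h : s % 42 ∉ residueClasses_fortyOne) :
    legendreSym 41 (edsZ s) = -1 :=
  legendreSym_edsZ_eq_neg_one (d := 41) (r := 42) (N := 42) (by decide) (by decide)
    (fun n => ((edsTable_fortyOne.getD n 0 : ℕ) : ZMod 41)) (by decide) residueClasses_fortyOne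
    (by decide) (by decide +kernel) (by decide +kernel) (by decide +kernel) (by decide +kernel)
    (by decide +kernel) (by decide +kernel) (by decide +kernel) (by decide +kernel)
    (by decide +kernel) 4 (by decide +kernel) (by decide) (by decide +kernel) hs h

def edsTable_fiftyThree : List ℕ := [0, 1, 1, 20, 3, 2, 19, 3, 51, 40, 30, 46, 24, 49, 48, 40,
    52, 46, 7, 29, 17, 21, 26, 10, 37, 14, 49, 44, 8, 39, 50, 46, 3, 13, 2, 44, 5, 45, 51, 28,
    24, 50, 25, 47, 32, 5, 17, 37, 9, 47, 7, 43, 45, 24, 10, 1, 35, 37, 50, 3, 48, 48, 48, 19,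
    13, 44, 0, 4, 38, 12, 33, 50, 34, 51, 48, 49, 51, 38, 4, 29, 33, 36, 10, 29, 16, 24, 24, 26,
    8, 17, 49, 20, 29, 17, 39, 34, 20, 37, 50, 9, 5, 38, 35, 51, 35, 9, 43, 45, 15, 40, 5, 48,
    24, 13, 15, 11, 15, 16, 5, 43, 9, 43, 14, 24, 3, 51, 14, 27, 18, 18, 11, 52]

def residueClasses_fiftyThree : List ℕ := [1, 9, 11, 13, 15, 17, 19, 23, 27, 31, 33, 35, 39, 43,
    47, 49, 51, 53, 55, 57, 65]

instance : Fact (Nat.Prime 53) := ⟨by norm_num⟩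

theorem legendreSym_fiftyThree {s : ℕ} (hs : Odd s) (h : s % 66 ∉ residueClasses_fiftyThree) :
    legendreSym 53 (edsZ s) = -1 :=
  legendreSym_edsZ_eq_neg_one (d := 53) (r := 66) (N := 66) (by decide) (by decide)
    (fun n => ((edsTable_fiftyThree.getD n 0 : ℕ) : ZMod 53)) (by decide) residueClasses_fiftyThree
    (by decide) (by decide +kernel) (by decide +kernel) (by decide +kernel) (by decide +kernel)
    (by decide +kernel) (by decide +kernel) (by decide +kernel) (by decide +kernel)
    (by decide +kernel) 6 (by decide +kernel) (by decide) (by decide +kernel) hs h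

/-! ### Inert primes in ℚ(√d). -/

theorem finrank_realQuadraticField {d : ℕ} (hd : d.Prime) :
    Module.finrank ℚ (realQuadraticField d) = 2 := by
  have hs : (√(d : ℝ)) ^ 2 = d := Real.sq_sqrt d.cast_nonneg
  have hirr : Irreducible (Polynomial.X ^ 2 - Polynomial.C (d : ℚ)) := by
    refine (X_pow_sub_C_irreducible_iff_of_prime Nat.prime_two).2 fun b hb => ?_
    refine hd.irrational_sqrt ⟨|b|, ?_⟩
    rw [← Rat.cast_natCast d, ← hb, Rat.cast_pow, Real.sqrt_sq_eq_abs, Rat.cast_abs]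
  have hint : IsIntegral ℚ (√(d : ℝ)) :=
    ⟨_, Polynomial.monic_X_pow_sub_C (d : ℚ) two_ne_zero, by simp [hs]⟩
  rw [IntermediateField.adjoin.finrank hint, ← minpoly.eq_of_irreducible_of_monic hirr
    (by simp [hs]) (Polynomial.monic_X_pow_sub_C (d : ℚ) two_ne_zero)]
  exact Polynomial.natDegree_X_pow_sub_C

/-- The ideal (p) has norm p². A maximal ideal above it of norm p would have residue field 𝔽_p,
where the image of √d is a square root of d. So its norm is p² and it equals (p). No explicit
integral basis is needed. -/
theorem isInertPrime_of_not_isSquare {p d : ℕ} (hp : p.Prime) (hd : d.Prime)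
    (h : ¬ IsSquare (d : ZMod p)) : IsInertPrime p d := by
  refine ⟨hp, ?_⟩
  have hint : IsIntegral ℚ (√(d : ℝ)) := by
    refine IsIntegral.of_pow (n := 2) two_pos ?_
    rw [Real.sq_sqrt d.cast_nonneg]
    simpa using isIntegral_algebraMap (R := ℚ) (A := ℝ) (x := (d : ℚ))
  have : FiniteDimensional ℚ (realQuadraticField d) :=
    IntermediateField.adjoin.finiteDimensional hint
  have : NumberField (realQuadraticField d) := ⟨⟩
  set K := realQuadraticField d
  let w : K := ⟨√(d : ℝ), IntermediateField.mem_adjoin_simple_self ℚ _⟩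
  have hw : w ^ 2 = d := by
    apply Subtype.ext
    simp [w, Real.sq_sqrt]
  have hwint : IsIntegral ℤ w := by
    refine IsIntegral.of_pow (n := 2) two_pos ?_
    rw [hw]
    exact_mod_cast isIntegral_algebraMap (R := ℤ) (A := K) (x := (d : ℤ))
  let θ : 𝓞 K := ⟨w, hwint⟩
  have hθ : θ ^ 2 = (d : 𝓞 K) := by
    apply NumberField.RingOfIntegers.ext
    exact hw
  set I : Ideal (𝓞 K) := Ideal.span {(p : 𝓞 K)} with hI
  have hnorm : Ideal.absNorm I = p ^ 2 := by
    rw [hI, Ideal.absNorm_span_singleton]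
    have : Algebra.norm ℤ (p : 𝓞 K) = (p : ℤ) ^ 2 := by
      have := Algebra.norm_algebraMap_of_basis (NumberField.RingOfIntegers.basis K) (p : ℤ)
      rw [← Module.finrank_eq_card_chooseBasisIndex, NumberField.RingOfIntegers.rank,
        finrank_realQuadraticField hd] at this
      simpa using this
    rw [this]; simp [Int.natAbs_pow]
  have hItop : I ≠ ⊤ := by
    intro e
    rw [e, Ideal.absNorm_top] at hnorm
    have := hp.one_lt
    nlinarith
  obtain ⟨P, hP, hIP⟩ := Ideal.exists_le_maximal I hItop
  obtain ⟨J, hJ⟩ := Ideal.dvd_iff_le.2 hIP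
  have hmul : Ideal.absNorm P * Ideal.absNorm J = p ^ 2 := by rw [← map_mul, ← hJ, hnorm]
  have hP1 : Ideal.absNorm P ≠ 1 := by
    rw [Ne, Ideal.absNorm_eq_one_iff]; exact hP.ne_top
  obtain ⟨k, hk, hPk⟩ := (Nat.dvd_prime_pow hp).1 ⟨_, hmul.symm⟩
  interval_cases k
  · simp at hPk; exact absurd hPk (by simpa using hP.ne_top)
  · exfalso
    rw [pow_one] at hPk
    have hcard : Nat.card (𝓞 K ⧸ P) = p := by
      rw [← hPk, Ideal.absNorm_apply, Submodule.cardQuot_apply]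
    have : Finite (𝓞 K ⧸ P) := Nat.finite_of_card_ne_zero (by rw [hcard]; exact hp.ne_zero)
    let := Fintype.ofFinite (𝓞 K ⧸ P)
    let e := ZMod.ringEquivOfPrime (𝓞 K ⧸ P) hp (by rw [← Nat.card_eq_fintype_card, hcard])
    apply h
    refine ⟨e.symm (Ideal.Quotient.mk P θ), ?_⟩
    rw [← map_mul, ← map_mul, ← pow_two, hθ]
    simp
  · have hJ1 : Ideal.absNorm J = 1 := by
      rw [hPk] at hmul
      exact Nat.eq_of_mul_eq_mul_left (pow_pos hp.pos 2) (by rw [hmul, mul_one])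
    rw [Ideal.absNorm_eq_one_iff] at hJ1
    rw [hJ1, Ideal.mul_top] at hJ
    rw [hJ]; exact hP.isPrime

theorem isInertPrime_of_legendreSym {p d : ℕ} [Fact d.Prime] (hd : d % 4 = 1) (hp : p.Prime)
    (hp2 : p ≠ 2) (h : legendreSym d p = -1) : IsInertPrime p d := by
  have : Fact p.Prime := ⟨hp⟩
  refine isInertPrime_of_not_isSquare hp Fact.out fun hsq => ?_
  rw [← legendreSym.quadratic_reciprocity_one_mod_four hd hp2] at h
  rw [legendreSym.eq_neg_one_iff] at h
  exact h (by simpa using hsq)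

/-! ### Combining the five tests and counting classes modulo 105336. -/

theorem hasPrimitiveOddOrderDivisor_of_mod {s : ℕ} (hs : s.Prime) (hs2 : s ≠ 2)
    (h : s % 8 ∉ residueClasses_five ∨ s % 18 ∉ residueClasses_thirteen ∨
      s % 38 ∉ residueClasses_twentyNine ∨ s % 42 ∉ residueClasses_fortyOne ∨
      s % 66 ∉ residueClasses_fiftyThree) :
    HasPrimitiveOddOrderDivisor (inertPrimes {5, 13, 29, 41, 53}) (ellDivSeq pointP) s := by
  have hodd := hs.odd_of_ne_two hs2
  have main : ∀ d : ℕ, ∀ _ : Fact d.Prime, d ∈ ({5, 13, 29, 41, 53} : Finset ℕ) → d % 4 = 1 →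
      legendreSym d (edsZ s) = -1 →
      HasPrimitiveOddOrderDivisor (inertPrimes {5, 13, 29, 41, 53}) (ellDivSeq pointP) s := by
    intro d _ hd hd4 hl
    obtain ⟨p, hp, hlp, hp2, hv, hi⟩ := exists_primitive_divisor_of_legendreSym hd4 hs hs2 hl
    exact ⟨p, ⟨d, hd, isInertPrime_of_legendreSym hd4 hp hp2 hlp⟩, hp, hv, hi⟩
  rcases h with h | h | h | h | h
  · exact main 5 inferInstance (by decide) rfl (legendreSym_five hodd h)
  · exact main 13 inferInstance (by decide) rfl (legendreSym_thirteen hodd h)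
  · exact main 29 inferInstance (by decide) rfl (legendreSym_twentyNine hodd h)
  · exact main 41 inferInstance (by decide) rfl (legendreSym_fortyOne hodd h)
  · exact main 53 inferInstance (by decide) rfl (legendreSym_fiftyThree hodd h)

/-- The invertible classes in which none of the five quadratic symbols is known to be `-1`. -/
def exceptionalClasses : Finset (ZMod 105336) :=
  {a | a.val.Coprime 105336 ∧ a.val % 8 ∈ residueClasses_five ∧
    a.val % 18 ∈ residueClasses_thirteen ∧ a.val % 38 ∈ residueClasses_twentyNine ∧
    a.val % 42 ∈ residueClasses_fortyOne ∧ a.val % 66 ∈ residueClasses_fiftyThree}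

/-- The conditions modulo 18, 42, 66 share the factor 3, so they are counted jointly modulo their
least common multiple 1386. Since 105336 = lcm(8, 38, 1386), a class is determined by its three
residues, which gives at most 2 · 12 · 48 possibilities. -/
theorem card_exceptionalClasses_le : exceptionalClasses.card ≤ 1152 := by
  let B₁ : Finset ℕ := {t ∈ Finset.range 8 | t ∈ residueClasses_five}
  let B₂ : Finset ℕ := {t ∈ Finset.range 38 | t.Coprime 38 ∧ t ∈ residueClasses_twentyNine}
  let B₃ : Finset ℕ := {t ∈ Finset.range 1386 | t.Coprime 1386 ∧ t % 18 ∈ residueClasses_thirteen ∧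
    t % 42 ∈ residueClasses_fortyOne ∧ t % 66 ∈ residueClasses_fiftyThree}
  have hB : (B₁ ×ˢ B₂ ×ˢ B₃).card = 1152 := by
    have h₁ : B₁.card = 2 := by decide +kernel
    have h₂ : B₂.card = 12 := by decide +kernel
    have h₃ : B₃.card = 48 := by decide +kernel
    rw [Finset.card_product, Finset.card_product, h₁, h₂, h₃]
  rw [← hB]
  refine Finset.card_le_card_of_injOn (fun a => (a.val % 8, a.val % 38, a.val % 1386)) ?_ ?_
  · intro a ha
    have ha' := (Finset.mem_filter.1 (Finset.mem_coe.1 ha)).2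
    obtain ⟨h0, h1, h2, h3, h4, h5⟩ := ha'
    have hc : ∀ k, k ∣ 105336 → (a.val % k).Coprime k := fun k hk => by
      have := h0.coprime_dvd_right hk
      rwa [Nat.Coprime, Nat.gcd_comm, Nat.gcd_rec] at this
    simp only [Finset.coe_product, Set.mem_prod, Finset.mem_coe, B₁, B₂, B₃, Finset.mem_filter,
      Finset.mem_range]
    refine ⟨⟨Nat.mod_lt _ (by norm_num), h1⟩, ⟨Nat.mod_lt _ (by norm_num), hc 38 (by norm_num), h3⟩,
      Nat.mod_lt _ (by norm_num), hc 1386 (by norm_num), ?_, ?_, ?_⟩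
    · rwa [Nat.mod_mod_of_dvd _ (by norm_num)]
    · rwa [Nat.mod_mod_of_dvd _ (by norm_num)]
    · rwa [Nat.mod_mod_of_dvd _ (by norm_num)]
  · intro a _ b _ hab
    simp only [Prod.mk.injEq] at hab
    have ha := ZMod.val_lt a
    have hb := ZMod.val_lt b
    apply ZMod.val_injective
    obtain ⟨h1, h2, h3⟩ := hab
    omega

theorem totient_105336 : Nat.totient 105336 = 25920 := by
  rw [show 105336 = 72 * 1463 by norm_num, Nat.totient_mul (by norm_num),
    show Nat.totient 72 = 24 by decide +kernel, show Nat.totient 1463 = 1080 by decide +kernel]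

theorem card_filter_val_coprime (q : ℕ) [NeZero q] :
    ({a : ZMod q | a.val.Coprime q} : Finset (ZMod q)).card = q.totient := by
  rw [← ZMod.card_units_eq_totient, ← Finset.card_univ]
  symm
  refine Finset.card_bij (fun u _ => (u : ZMod q)) ?_ ?_ ?_
  · intro u _
    exact Finset.mem_filter.2 ⟨Finset.mem_univ _, ZMod.val_coe_unit_coprime u⟩
  · intro u _ v _ h
    exact Units.ext h
  · intro b hb
    exact ⟨ZMod.unitOfCoprime b.val (Finset.mem_filter.1 hb).2, Finset.mem_univ _, by simp⟩

theorem mainTheorem6 :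
    (95.5 / 100 : ℝ) ≤ 43 / 45 ∧
    (43 / 45 : ℝ) ≤ lowerDirichletDensity
      {s : ℕ | s.Prime ∧
        HasPrimitiveOddOrderDivisor (inertPrimes {5, 13, 29, 41, 53}) (ellDivSeq pointP) s} := by
  refine ⟨by norm_num, ?_⟩
  let U : Finset (ZMod 105336) := {a | a.val.Coprime 105336}
  have hU : U.card = 25920 := by rw [← totient_105336]; exact card_filter_val_coprime _
  have hsub : exceptionalClasses ⊆ U := fun a ha =>
    Finset.mem_filter.2 ⟨Finset.mem_univ _, (Finset.mem_filter.1 ha).2.1⟩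
  -- 24768 = 25920 - 1152, and 24768 / 25920 = 43/45.
  have hcard : 24768 ≤ (U \ exceptionalClasses).card := by
    rw [Finset.card_sdiff_of_subset hsub, hU]
    have := card_exceptionalClasses_le
    omega
  have hunit : ∀ a ∈ U, IsUnit a := fun a ha => by
    rw [← ZMod.natCast_zmod_val a, ZMod.isUnit_iff_coprime]
    exact (Finset.mem_filter.1 ha).2
  refine le_trans ?_ (card_div_totient_le_lowerDirichletDensity (U \ exceptionalClasses)
    (fun a ha => hunit a (Finset.mem_sdiff.1 ha).1) fun s hs hsA => ?_)
  · rw [totient_105336, div_le_div_iff₀ (by norm_num) (by norm_num)]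
    have : (24768 : ℝ) ≤ ((U \ exceptionalClasses).card : ℝ) := by exact_mod_cast hcard
    push_cast
    linarith
  · obtain ⟨hsU, hsE⟩ := Finset.mem_sdiff.1 hsA
    have hcop := (Finset.mem_filter.1 hsU).2
    refine ⟨hs, hasPrimitiveOddOrderDivisor_of_mod hs ?_ ?_⟩
    · rintro rfl
      exact absurd (hunit _ hsU) (by rw [ZMod.isUnit_iff_coprime]; norm_num)
    · by_contra! hc
      refine hsE (Finset.mem_filter.2 ⟨Finset.mem_univ _, hcop, ?_⟩)
      rw [ZMod.val_natCast]
      rw [Nat.mod_mod_of_dvd _ (by norm_num), Nat.mod_mod_of_dvd _ (by norm_num),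
        Nat.mod_mod_of_dvd _ (by norm_num), Nat.mod_mod_of_dvd _ (by norm_num),
        Nat.mod_mod_of_dvd _ (by norm_num)]
      exact hc
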